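/- Let $\Gamma$ be a discrete group and let $Y\subset\Gamma$ be a finite set with $|Y|=q+1$ elements, where $q\ge 1$. For $a$ in the group ring $\mathbb{C}\Gamma$ let $\|a\|=\|\lambda(a)\|_{B(\ell^2(\Gamma))}$, where $\lambda$ is the left regular representation, $(\lambda(x)f)(y)=f(x^{-1}y)$, extended linearly to $\mathbb{C}\Gamma$; let $\tau(a)=\langle\lambda(a)\delta_e,\delta_e\rangle$ and $\|a\|_2=\tau(a^*a)^{1/2}$. Let $h=\sum_{s\in Y}s\in\mathbb{C}\Gamma$. For $n\ge 1$ let $$E_n=\{(s_1,\dots,s_n)\in Y^n : s_i\ne s_{i+1}\ (1\le i\le n-1)\},\qquad \tilde E_n=\{(s_1,\dots,s_n)\in E_n : s_1\ne s_n\},$$ $$h_n=\sum_{(s_1,\dots,s_n)\in E_n}s_1^{-1}s_2\cdots s_{n-1}^{-1}s_n\ \ (n\text{ even}),\qquad h_n=\sum_{(s_1,\dots,s_n)\in E_n}s_1s_2^{-1}s_3\cdots s_{n-1}^{-1}s_n\ \ (n\text{ odd}),$$ $$z_n=\sum_{(s_1,\dots,s_{2n})\in\tilde E_{2n}}s_1^{-1}s_2\cdots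 s_{2n-1}^{-1}s_{2n},$$ $$\xi_n=\|h_n\|_2^2-(q+1)q^{n-1},\qquad \eta_n=\tau(h_{2n}),\qquad \zeta_n=\tau(z_n).$$ The set $Y$ is called a Leinert set if $s_1^{-1}s_2\cdots s_{2n-1}^{-1}s_{2n}\ne e$ for all $n\ge 1$ and all $(s_1,\dots,s_{2n})\in E_{2n}$. Put $$\gamma=\tfrac12\Bigl(\|h\|+\sqrt{\|h\|^2-4q}\Bigr).$$ Then $$\sqrt q\le\gamma\le q\qquad\text{and}\qquad \gamma+\frac q\gamma=\|h\|.$$ If moreover $Y$ is not a Leinert set and $q\ge 2$, then $\gamma>\sqrt q$ and $$\gamma=\lim_{n\to\infty}\|h_n\|_2^{1/n}=\lim_{n\to\infty}\xi_n^{1/(2n)}=\lim_{n\to\infty}\eta_n^{1/(2n)}=\lim_{n\to\infty}\zeta_n^{1/(2n)}.$$ -/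

import Mathlib

open Filter Topology

noncomputable section

namespace Cogrowth

variable {Γ : Type*} [Group Γ]

/-- The Hilbert space `ℓ²(Γ)` of complex-valued square-summable functions on `Γ`. -/
abbrev L2 (Γ : Type*) : Type _ := lp (fun _ : Γ => ℂ) 2

/-- Left translates of square-summable functions are square-summable. -/
theorem memℓp_translate (x : Γ) (f : L2 Γ) :
    Memℓp (fun y : Γ => (f : Γ → ℂ) (x⁻¹ * y)) 2 := by
  have hp : 0 < (2 : ENNReal).toReal := by norm_num
  have hf := (memℓp_gen_iff hp).1 (lp.memℓp f)
  exact (memℓp_gen_iff hp).2 ((Equiv.mulLeft x⁻¹).summable_iff.2 hf)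

/-- The isometry `λ(x)` of `ℓ²(Γ)`, given by `(λ(x) f)(y) = f (x⁻¹ y)`. -/
def translate (x : Γ) : L2 Γ →ₗᵢ[ℂ] L2 Γ where
  toFun f := ⟨fun y => (f : Γ → ℂ) (x⁻¹ * y), memℓp_translate x f⟩
  map_add' _ _ := rfl
  map_smul' _ _ := rfl
  norm_map' f := by
    have hp : 0 < (2 : ENNReal).toReal := by norm_num
    rw [lp.norm_eq_tsum_rpow hp, lp.norm_eq_tsum_rpow hp]
    congr 1
    exact (Equiv.mulLeft x⁻¹).tsum_eq (fun y => ‖(f : Γ → ℂ) y‖ ^ (2 : ENNReal).toReal)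

/-- The left regular representation of `Γ` by bounded operators on `ℓ²(Γ)`. -/
def leftRegularRep (Γ : Type*) [Group Γ] : Γ →* (L2 Γ →L[ℂ] L2 Γ) where
  toFun x := (translate x).toContinuousLinearMap
  map_one' := by
    ext f y
    change (f : Γ → ℂ) (1⁻¹ * y) = (f : Γ → ℂ) y
    simp
  map_mul' a b := by
    ext f y
    change (f : Γ → ℂ) ((a * b)⁻¹ * y) = (f : Γ → ℂ) (b⁻¹ * (a⁻¹ * y))
    simp [mul_assoc]

/-- The extension `λ` of the left regular representation to the complex group ring `ℂΓ`. -/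
def regularRep (Γ : Type*) [Group Γ] : MonoidAlgebra ℂ Γ →ₐ[ℂ] (L2 Γ →L[ℂ] L2 Γ) :=
  MonoidAlgebra.lift ℂ (L2 Γ →L[ℂ] L2 Γ) Γ (leftRegularRep Γ)

/-- The norm `‖a‖ = ‖λ(a)‖` of an element of the group ring: the operator norm on `ℓ²(Γ)`. -/
def opNorm (a : MonoidAlgebra ℂ Γ) : ℝ := ‖regularRep Γ a‖

open Classical in
/-- The vector `δ_e` of `ℓ²(Γ)`. -/
def deltaOne (Γ : Type*) [Group Γ] : L2 Γ := lp.single 2 (1 : Γ) (1 : ℂ)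

/-- The functional `τ(T) = ⟨T δ_e, δ_e⟩` (Mathlib's `inner` is linear in its second argument). -/
def trace (T : L2 Γ →L[ℂ] L2 Γ) : ℂ := inner ℂ (deltaOne Γ) (T (deltaOne Γ))

/-- The 2-norm `‖a‖₂ = τ(a* a)^{1/2}` of an element of the group ring; the trace of the positive
operator `λ(a)* λ(a)` is a nonnegative real number. -/
def twoNorm (a : MonoidAlgebra ℂ Γ) : ℝ :=
  √(trace (ContinuousLinearMap.adjoint (regularRep Γ a) * regularRep Γ a)).re

open Classical in
/-- `E_n`: the tuples `(s_1, …, s_n)` in `Y ^ n` with `s_1 ≠ s_2 ≠ ⋯ ≠ s_n`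
(consecutive entries are distinct). -/
def words (Y : Finset Γ) (n : ℕ) : Finset (Fin n → Γ) :=
  (Fintype.piFinset fun _ => Y).filter fun s =>
    ∀ (i : ℕ) (hi : i + 1 < n), s ⟨i, Nat.lt_of_succ_lt hi⟩ ≠ s ⟨i + 1, hi⟩

open Classical in
/-- The cyclic version of `E_n`: the tuples in `E_n` with moreover `s_1 ≠ s_n`. -/
def cyclicWords (Y : Finset Γ) (n : ℕ) : Finset (Fin n → Γ) :=
  (words Y n).filter fun s =>
    ∀ hn : 0 < n, s ⟨0, hn⟩ ≠ s ⟨n - 1, Nat.sub_lt hn Nat.one_pos⟩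

/-- The alternating product, in which the last factor is `s_n`, the one before it `s_{n-1}⁻¹`, and
so on: `s_1⁻¹ s_2 ⋯ s_{n-1}⁻¹ s_n` for `n` even, and `s_1 s_2⁻¹ s_3 ⋯ s_{n-1}⁻¹ s_n` for `n` odd. -/
def altProd {n : ℕ} (s : Fin n → Γ) : Γ :=
  (List.ofFn fun i => if Even (i.rev : ℕ) then s i else (s i)⁻¹).prod

/-- The element `h = ∑_{s ∈ Y} s` of the group ring. -/
def sumElt (Y : Finset Γ) : MonoidAlgebra ℂ Γ := ∑ s ∈ Y, MonoidAlgebra.of ℂ Γ s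

/-- The element `h_n` of the group ring: the sum over `E_n` of the alternating products. -/
def hSeq (Y : Finset Γ) (n : ℕ) : MonoidAlgebra ℂ Γ :=
  ∑ s ∈ words Y n, MonoidAlgebra.of ℂ Γ (altProd s)

/-- The element `z_n` of the group ring: the cyclic version of `h_{2n}`. -/
def zSeq (Y : Finset Γ) (n : ℕ) : MonoidAlgebra ℂ Γ :=
  ∑ s ∈ cyclicWords Y (2 * n), MonoidAlgebra.of ℂ Γ (altProd s)

/-- `ξ_n = ‖h_n‖₂² - (q + 1) q^{n-1}` with `q + 1 = |Y|` (for `n ≥ 1`, and `Y` non-empty). -/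
def xi (Y : Finset Γ) (n : ℕ) : ℝ :=
  twoNorm (hSeq Y n) ^ 2 - (Y.card : ℝ) * ((Y.card : ℝ) - 1) ^ (n - 1)

/-- `η_n = τ(h_{2n})`. This trace is the number of tuples in `E_{2n}` with alternating product `e`,
so that taking the real part loses nothing. -/
def eta (Y : Finset Γ) (n : ℕ) : ℝ := (trace (regularRep Γ (hSeq Y (2 * n)))).re

/-- `ζ_n = τ(z_n)`. This trace is the number of cyclic tuples of length `2n` with alternating
product `e`, so that taking the real part loses nothing. -/
def zeta (Y : Finset Γ) (n : ℕ) : ℝ := (trace (regularRep Γ (zSeq Y n))).re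

/-- `Y` is a Leinert set if `s_1⁻¹ s_2 ⋯ s_{2n-1}⁻¹ s_{2n} ≠ e` for all `n ≥ 1` and all
`(s_1, …, s_{2n})` in `E_{2n}`. -/
def IsLeinert (Y : Finset Γ) : Prop :=
  ∀ n : ℕ, 1 ≤ n → ∀ s ∈ words Y (2 * n), altProd s ≠ 1

end Cogrowth

end

set_option linter.unusedSectionVars false

/-! Write `a = λ(h)* λ(h)`, so `‖a‖ = ‖h‖²`, and let `T_n` be the rescaled Chebyshev polynomials
`cheb`, with `T_n((u + q/u)²) = u²ⁿ + (q/u)²ⁿ`. Once `‖h‖² ≥ 4q` is known, `γ` is the larger root of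
`u + q/u = ‖h‖`, and `|T_n| ≤ 2γ²ⁿ` on the spectrum of `a`.

Upper bound: prepending letters gives a recursion for `h_n`, hence `h_{2n+4} - q h_{2n+2} =
T_{n+2}(h*h) - T_{n+1}(h*h)` (`hSeq_sub`). Summing, `‖h_n‖`, and a fortiori `‖h_n‖₂`, is at most a
polynomial in `n` times `γⁿ`.

Lower bound: counting closed words up to conjugation (`card_closedWords_succ_add`) and taking traces
in the same identity gives `ζ_n = τ(T_n(h*h)) + q - 1` (`zeta_eq_trace`). Since `δ_e` is separating
for the bicommutant of `a`, its spectral measure charges every neighbourhood of `‖a‖`. So `ζ_n ≥ c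
u²ⁿ` eventually, for every `u < γ`, as soon as `γ > √q`: the part of the spectrum below `4q`
contributes only `O(qⁿ)`. The chain `ζ_n ≤ η_n ≤ ξ_n ≤ ‖h_n‖₂²` then squeezes all four sequences.

The norm: a homomorphism does not decrease the norm of a positive element with nonnegative
coefficients (`opNorm_le_opNorm_mapDomain`), so `‖h‖` may be bounded below in the free group on `Y`.
There the truncations `f_K` of a spherical function satisfy `‖f_K‖² ~ K` with a bounded defect `(a -
4q) f_K`, which gives `‖h‖² ≥ 4q`. If a nonempty reduced word `w` of length `2m` becomes trivial in
`Γ`, then `2(h*h)ᵐ - w - w⁻¹ + 2` still has nonnegative coefficients and has image `2(h*h)ᵐ`. On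
`f_K` it gains `‖f_K - λ(w) f_K‖²`, of order `K` when `q ≥ 2`, against an error of order `√K`. Hence
`‖h‖² > 4q`. -/

noncomputable section

namespace Cogrowth

/-! ### Words as lists -/

section Words

variable {Γ : Type*} [Group Γ]

/-- The alternating product of a list, in which the last factor is not inverted. -/
def listProd : List Γ → Γ
  | [] => 1
  | a :: l => (if Even l.length then a else a⁻¹) * listProd l

theorem altProd_eq_listProd {n : ℕ} (s : Fin n → Γ) : altProd s = listProd (List.ofFn s) := by
  induction n with
  | zero => simp [altProd, listProd]
  | succ n ih =>
    rw [List.ofFn_succ, listProd, ← ih (fun i => s i.succ)]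
    simp only [altProd, List.ofFn_succ, List.prod_cons, List.length_ofFn, Fin.rev_zero,
      Fin.val_last, Fin.rev_succ, Fin.val_castSucc]

open Classical in
/-- The words of `words Y n`, as lists. -/
def listWords (Y : Finset Γ) (n : ℕ) : Finset (List Γ) := (words Y n).image List.ofFn

theorem mem_listWords {Y : Finset Γ} {n : ℕ} {l : List Γ} :
    l ∈ listWords Y n ↔ l.length = n ∧ (∀ x ∈ l, x ∈ Y) ∧ l.IsChain (· ≠ ·) := by
  simp only [listWords, Finset.mem_image, words, Finset.mem_filter, Fintype.mem_piFinset]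
  constructor
  · rintro ⟨s, ⟨hs, hc⟩, rfl⟩
    refine ⟨List.length_ofFn, ?_, List.isChain_ofFn.2 hc⟩
    intro x hx
    obtain ⟨i, rfl⟩ := (List.mem_ofFn' s x).1 hx
    exact hs i
  · rintro ⟨rfl, hY, hc⟩
    refine ⟨l.get, ⟨fun i => hY _ (List.get_mem l i), ?_⟩, List.ofFn_get l⟩
    rw [← List.ofFn_get l] at hc
    exact List.isChain_ofFn.1 hc

theorem sum_words {A : Type*} [AddCommMonoid A] (Y : Finset Γ) (n : ℕ) (F : List Γ → A) :
    ∑ s ∈ words Y n, F (List.ofFn s) = ∑ l ∈ listWords Y n, F l := by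
  classical
  rw [listWords, Finset.sum_image (fun _ _ _ _ h => List.ofFn_injective h)]

theorem hSeq_eq (Y : Finset Γ) (n : ℕ) :
    hSeq Y n = ∑ l ∈ listWords Y n, MonoidAlgebra.of ℂ Γ (listProd l) := by
  rw [hSeq, ← sum_words]
  simp only [altProd_eq_listProd]

open Classical in
/-- The words of `cyclicWords Y n`, as lists. -/
def cyclicListWords (Y : Finset Γ) (n : ℕ) : Finset (List Γ) :=
  (listWords Y n).filter fun l => l.head? ≠ l.getLast?

theorem zSeq_eq (Y : Finset Γ) {n : ℕ} (hn : n ≠ 0) :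
    zSeq Y n = ∑ l ∈ cyclicListWords Y (2 * n), MonoidAlgebra.of ℂ Γ (listProd l) := by
  classical
  rw [zSeq, cyclicListWords, Finset.sum_filter, ← sum_words, cyclicWords, Finset.sum_filter]
  refine Finset.sum_congr rfl fun s _ => ?_
  rw [altProd_eq_listProd]
  congr 1
  have h0 : 0 < 2 * n := by omega
  rw [eq_iff_iff]
  have h1 : (List.ofFn s).head? = some (s ⟨0, h0⟩) := by
    rw [List.head?_eq_getElem?, List.getElem?_ofFn, dif_pos h0]
  have h2 : (List.ofFn s).getLast? = some (s ⟨2 * n - 1, Nat.sub_lt h0 Nat.one_pos⟩) := by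
    rw [List.getLast?_eq_getElem?, List.length_ofFn, List.getElem?_ofFn, dif_pos]
  rw [h1, h2]
  simp [h0]

theorem isLeinert_iff (Y : Finset Γ) :
    IsLeinert Y ↔ ∀ n : ℕ, 1 ≤ n → ∀ l ∈ listWords Y (2 * n), listProd l ≠ 1 := by
  simp only [IsLeinert, listWords, Finset.mem_image, altProd_eq_listProd]
  constructor
  · rintro h n hn _ ⟨s, hs, rfl⟩
    exact h n hn s hs
  · intro h n hn s hs
    exact h n hn _ ⟨s, hs, rfl⟩

/-- Signs are counted from the right end, so equal parity of the two lengths is what makes them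
alternate across the junction. Equal products thereby correspond to closed words. -/
theorem inv_listProd_mul_listProd (l l' : List Γ) (h : Even (l.length + l'.length)) :
    (listProd l)⁻¹ * listProd l' = listProd (l.reverse ++ l') := by
  induction l generalizing l' with
  | nil => simp [listProd]
  | cons a l ih =>
    have h' : Even (l.length + (a :: l').length) := by
      simpa [add_assoc, add_comm, add_left_comm] using h
    rw [List.reverse_cons, List.append_assoc, List.singleton_append, ← ih _ h', listProd, listProd]
    have : Even l'.length ↔ ¬ Even l.length := by
      simp only [List.length_cons] at h
      grind
    by_cases hl : Even l.length <;> simp [this, hl, mul_assoc]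

/-- A new last letter shifts every other position by one and so flips all their signs. This is why
the set of inverses enters the counting below. -/
theorem listProd_append_singleton (l : List Γ) (a : Γ) :
    listProd (l ++ [a]) = listProd (l.map (·⁻¹)) * a := by
  induction l with
  | nil => simp [listProd]
  | cons b l ih =>
    simp only [List.cons_append, listProd, ih, List.map_cons, List.length_append,
      List.length_singleton, List.length_map, mul_assoc]
    by_cases hl : Even l.length <;> simp [hl, Nat.even_add_one]

theorem listProd_cons_of_even {l : List Γ} (h : Even l.length) (a : Γ) :
    listProd (a :: l) = a * listProd l := by simp [listProd, h]

theorem listProd_cons_of_odd {l : List Γ} (h : ¬ Even l.length) (a : Γ) :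
    listProd (a :: l) = a⁻¹ * listProd l := by simp [listProd, h]

theorem listWords_zero (Y : Finset Γ) : listWords Y 0 = {[]} := by
  ext l
  simp only [mem_listWords, List.length_eq_zero_iff, Finset.mem_singleton]
  constructor
  · exact fun h => h.1
  · rintro rfl
    simp

theorem cons_mem_listWords {Y : Finset Γ} {n : ℕ} {a : Γ} {l : List Γ} :
    a :: l ∈ listWords Y (n + 1) ↔ a ∈ Y ∧ l ∈ listWords Y n ∧ l.head? ≠ some a := by
  cases l with
  | nil => simp [mem_listWords, and_comm, eq_comm]
  | cons b l =>
    simp only [mem_listWords, List.length_cons, List.mem_cons, List.isChain_cons_cons,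
      List.head?_cons, ne_eq, Option.some.injEq]
    grind

open Classical in
theorem sum_listWords_succ {A : Type*} [AddCommMonoid A] (Y : Finset Γ) (n : ℕ)
    (F : List Γ → A) :
    ∑ l ∈ listWords Y (n + 1), F l =
      ∑ a ∈ Y, ∑ l ∈ listWords Y n with l.head? ≠ some a, F (a :: l) := by
  rw [Finset.sum_sigma']
  symm
  refine Finset.sum_bij (fun p _ => p.1 :: p.2) ?_ ?_ ?_ ?_
  · rintro ⟨a, l⟩ h
    simp only [Finset.mem_sigma, Finset.mem_filter] at h
    exact cons_mem_listWords.2 h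
  · rintro ⟨a, l⟩ _ ⟨b, l'⟩ _ h
    simp only [List.cons.injEq] at h
    obtain ⟨rfl, rfl⟩ := h
    rfl
  · intro l hl
    cases l with
    | nil => simp [mem_listWords] at hl
    | cons a l => exact ⟨⟨a, l⟩, by simpa using cons_mem_listWords.1 hl, rfl⟩
  · intros
    rfl

open Classical in
theorem card_filter_head_ne {Y : Finset Γ} {q : ℕ} (hY : Y.card = q + 1) (n : ℕ) {a : Γ}
    (ha : a ∈ Y) : ((listWords Y n).filter fun l => l.head? ≠ some a).card = q ^ n := by
  induction n generalizing a with
  | zero => rw [listWords_zero, Finset.filter_true_of_mem (by simp), pow_zero, Finset.card_singleton]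
  | succ n ih =>
    rw [Finset.card_eq_sum_ones, Finset.sum_filter, sum_listWords_succ]
    have : ∀ b ∈ Y, (∑ l ∈ listWords Y n with l.head? ≠ some b,
        if (b :: l).head? ≠ some a then 1 else 0) = if b ≠ a then q ^ n else 0 := by
      intro b hb
      by_cases hba : b = a
      · simp [hba]
      · simpa [hba] using ih hb
    rw [Finset.sum_congr rfl this, ← Finset.sum_filter, Finset.sum_const, Finset.filter_ne',
      Finset.card_erase_of_mem ha, hY, smul_eq_mul, pow_succ', Nat.add_sub_cancel]

theorem card_listWords_succ {Y : Finset Γ} {q : ℕ} (hY : Y.card = q + 1) (n : ℕ) :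
    (listWords Y (n + 1)).card = (q + 1) * q ^ n := by
  classical
  rw [Finset.card_eq_sum_ones, sum_listWords_succ, Finset.sum_congr rfl (g := fun _ => q ^ n)]
  · simp [hY]
  · intro a ha
    rw [← card_filter_head_ne hY n ha, Finset.card_eq_sum_ones]

/-- The recursion for sums over words, obtained by prepending a letter. -/
theorem sum_cons_listWords {A : Type*} [AddCommMonoid A] {Y : Finset Γ} {q : ℕ}
    (hY : Y.card = q + 1) (n : ℕ) (F : List Γ → A) (G : List Γ → A)
    (hFG : ∀ a l, F (a :: a :: l) = G l) :
    ∑ a ∈ Y, ∑ l ∈ listWords Y (n + 1), F (a :: l) =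
      ∑ l ∈ listWords Y (n + 2), F l +
        (if n = 0 then q + 1 else q) • ∑ l ∈ listWords Y n, G l := by
  classical
  rw [sum_listWords_succ Y (n + 1), Finset.sum_congr rfl (fun a _ =>
    (Finset.sum_filter_add_sum_filter_not (listWords Y (n + 1)) (fun l => l.head? ≠ some a)
      (fun l => F (a :: l))).symm), Finset.sum_add_distrib]
  congr 1
  -- When the first letter equals `a`, the two cancel; what remains is the tail, which does not
  -- begin with `a`.
  have h1 : ∀ a ∈ Y, (∑ l ∈ listWords Y (n + 1) with ¬ l.head? ≠ some a, F (a :: l)) =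
      ∑ l ∈ listWords Y n with l.head? ≠ some a, G l := by
    intro a ha
    rw [Finset.sum_filter, sum_listWords_succ, Finset.sum_eq_single_of_mem a ha]
    · simp [hFG]
    · intro b _ hb
      simp [hb]
  rw [Finset.sum_congr rfl h1]
  simp_rw [Finset.sum_filter]
  rw [Finset.sum_comm, Finset.smul_sum]
  refine Finset.sum_congr rfl fun l hl => ?_
  -- A given tail `l` arises once for each letter other than its head: `q` letters, or all `q + 1`
  -- when `l` is empty.
  rw [← Finset.sum_filter, Finset.sum_const]
  congr 1
  rcases l with _ | ⟨b, l⟩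
  · have : n = 0 := by simpa [eq_comm] using (mem_listWords.1 hl).1
    simp [this, hY]
  · obtain ⟨hlen, hmem, -⟩ := mem_listWords.1 hl
    have hn : n ≠ 0 := by
      rintro rfl
      simp at hlen
    have hb : b ∈ Y := hmem b (by simp)
    simp only [List.head?_cons, ne_eq, Option.some.injEq, hn, if_false]
    rw [Finset.filter_congr (fun x _ => not_congr (eq_comm (a := b) (b := x))), Finset.filter_ne',
      Finset.card_erase_of_mem hb, hY, Nat.add_sub_cancel]

end Words

/-! ### Counting closed words -/

section Counting

variable {Γ : Type*} [Group Γ]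

open Classical in
/-- The closed words of length `2 * n`. -/
def closedWords (Y : Finset Γ) (n : ℕ) : Finset (List Γ) :=
  (listWords Y (2 * n)).filter fun l => listProd l = 1

open Classical in
/-- The closed words of length `2 * n` which are cyclically reduced. -/
def cyclicClosedWords (Y : Finset Γ) (n : ℕ) : Finset (List Γ) :=
  (closedWords Y n).filter fun l => l.head? ≠ l.getLast?

open Classical in
/-- The closed words of length `2 * n` which are not cyclically reduced. -/
def acyclicClosedWords (Y : Finset Γ) (n : ℕ) : Finset (List Γ) :=
  (closedWords Y n).filter fun l => ¬ l.head? ≠ l.getLast?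

theorem card_cyclicClosedWords_add (Y : Finset Γ) (n : ℕ) :
    (cyclicClosedWords Y n).card + (acyclicClosedWords Y n).card = (closedWords Y n).card := by
  classical
  exact Finset.card_filter_add_card_filter_not _

/-- The set of inverses. -/
def invSet (Y : Finset Γ) : Finset Γ := Y.map (Equiv.inv Γ).toEmbedding

theorem mem_invSet {Y : Finset Γ} {x : Γ} : x ∈ invSet Y ↔ x⁻¹ ∈ Y := by
  simp [invSet, Finset.mem_map_equiv]

theorem invSet_invSet (Y : Finset Γ) : invSet (invSet Y) = Y := by
  ext x
  simp [mem_invSet]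

theorem card_invSet (Y : Finset Γ) : (invSet Y).card = Y.card := Finset.card_map _

theorem map_inv_mem_listWords {Y : Finset Γ} {n : ℕ} {l : List Γ} :
    l.map (·⁻¹) ∈ listWords (invSet Y) n ↔ l ∈ listWords Y n := by
  have h : (∀ x ∈ l.map (·⁻¹), x ∈ invSet Y) ↔ ∀ x ∈ l, x ∈ Y := by
    simp only [List.forall_mem_map, mem_invSet, inv_inv]
  simp only [mem_listWords, h, List.length_map, List.isChain_map, ne_eq, inv_inj]

theorem map_inv_map_inv (l : List Γ) : (l.map (·⁻¹)).map (·⁻¹) = l := by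
  simp

/-- Rotating by one place conjugates the product, and the condition at the two ends keeps the
rotated word reduced. The rotation flips all signs, which inverting the letters undoes. -/
theorem card_cyclicClosedWords_le_invSet (Y : Finset Γ) (n : ℕ) :
    (cyclicClosedWords Y n).card ≤ (cyclicClosedWords (invSet Y) n).card := by
  classical
  refine Finset.card_le_card_of_injOn (fun l => (l.rotate 1).map (·⁻¹)) ?_ ?_
  · intro l hl
    simp only [cyclicClosedWords, closedWords, Finset.mem_coe, Finset.mem_filter] at hl ⊢
    obtain ⟨⟨hl, h1⟩, hne⟩ := hl
    rw [map_inv_mem_listWords]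
    rcases l with _ | ⟨a, l⟩
    · simp at hne
    have hlen := (mem_listWords.1 hl).1
    have hodd : ¬ Even l.length := by
      rw [List.length_cons] at hlen
      grind
    have hrot : (a :: l).rotate 1 = l ++ [a] := by simp
    rw [hrot]
    rcases l with _ | ⟨b, l⟩
    · simp at hodd
    rw [listProd_cons_of_odd hodd] at h1
    obtain ⟨-, hY, hc⟩ := mem_listWords.1 hl
    refine ⟨⟨mem_listWords.2 ⟨by simpa using hlen, ?_, ?_⟩, ?_⟩, ?_⟩
    · intro x hx
      exact hY x (by simp at hx ⊢; tauto)
    · rw [List.isChain_append]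
      refine ⟨(List.isChain_cons_cons.1 hc).2, by simp, ?_⟩
      intro x hx y hy
      simp only [List.head?_cons, Option.mem_def, Option.some.injEq] at hy
      subst hy
      rintro rfl
      apply hne
      rw [List.getLast?_cons_cons, hx]
      rfl
    · rw [List.map_append, List.map_singleton, listProd_append_singleton, map_inv_map_inv]
      exact mul_eq_one_iff_inv_eq.2 (by rw [inv_mul_eq_one] at h1; rw [h1])
    · have := (List.isChain_cons_cons.1 hc).1
      simp only [List.map_cons, List.map_append, List.map_nil, List.getLast?_append,
        List.getLast?_singleton]
      simpa using this.symm
  · intro l _ l' _ h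
    exact List.rotate_injective 1 (List.map_injective_iff.2 inv_injective h)

theorem card_cyclicClosedWords_invSet (Y : Finset Γ) (n : ℕ) :
    (cyclicClosedWords (invSet Y) n).card = (cyclicClosedWords Y n).card := by
  refine le_antisymm ?_ (card_cyclicClosedWords_le_invSet Y n)
  conv_rhs => rw [← invSet_invSet Y]
  exact card_cyclicClosedWords_le_invSet (invSet Y) n

open Classical in
/-- Closed words which are not cyclically reduced are obtained from shorter ones by conjugation. -/
theorem card_acyclicClosedWords_succ (Y : Finset Γ) {n : ℕ} (hn : n ≠ 0) :
    (acyclicClosedWords Y (n + 1)).card =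
      ∑ l ∈ closedWords (invSet Y) n,
        ((invSet Y).filter fun x => l.head? ≠ some x ∧ l.getLast? ≠ some x).card := by
  -- A closed word with equal first and last letters is a conjugate of its core. The core sits at
  -- shifted parity, so it is a closed word in the inverses of its letters.
  rw [← Finset.card_sigma]
  symm
  refine Finset.card_bij (fun p _ => p.2⁻¹ :: (p.1.map (·⁻¹) ++ [p.2⁻¹])) ?_ ?_ ?_
  · rintro ⟨l, x⟩ h
    simp only [Finset.mem_sigma, Finset.mem_filter, closedWords] at h
    obtain ⟨⟨hl, h1⟩, hx, hh, ht⟩ := h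
    obtain ⟨hlen, hY, hc⟩ := mem_listWords.1 hl
    simp only [acyclicClosedWords, closedWords, Finset.mem_filter]
    have hl0 : l ≠ [] := by
      rintro rfl
      simp at hlen
      omega
    obtain ⟨b, l, rfl⟩ := List.exists_cons_of_ne_nil hl0
    refine ⟨⟨mem_listWords.2 ⟨?_, ?_, ?_⟩, ?_⟩, ?_⟩
    · simp only [List.length_cons, List.length_append, List.length_map, List.length_nil] at hlen ⊢
      omega
    · intro y hy
      simp only [List.mem_cons, List.mem_append, List.mem_map, List.not_mem_nil, or_false] at hy
      rcases hy with rfl | ⟨z, hz, rfl⟩ | rfl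
      · exact mem_invSet.1 hx
      · exact mem_invSet.1 (hY z (by simpa using hz))
      · exact mem_invSet.1 hx
    · rw [← List.cons_append, List.isChain_append]
      refine ⟨?_, by simp, ?_⟩
      · rw [List.map_cons, List.isChain_cons_cons]
        refine ⟨fun h => hh (by simp [inv_injective h]), ?_⟩
        rw [← List.map_cons, List.isChain_map]
        simpa using hc
      · intro y hy z hz
        simp only [List.head?_cons, Option.mem_def, Option.some.injEq] at hz
        subst hz
        rintro rfl
        apply ht
        rw [List.map_cons, List.getLast?_cons_cons, ← List.map_cons, List.getLast?_map] at hy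
        simpa using hy
    · rw [listProd_cons_of_odd (by simp [Nat.even_add_one] at hlen ⊢; grind),
        listProd_append_singleton, map_inv_map_inv, h1]
      simp
    · rw [← List.cons_append, List.getLast?_append]
      simp
  · rintro ⟨l, x⟩ _ ⟨l', x'⟩ _ h
    simp only [List.cons.injEq, inv_inj] at h
    obtain ⟨rfl, h⟩ := h
    have := List.map_injective_iff.2 inv_injective (List.append_cancel_right h)
    subst this
    rfl
  · intro l hl
    simp only [acyclicClosedWords, closedWords, Finset.mem_filter, not_not] at hl
    obtain ⟨⟨hl, h1⟩, hht⟩ := hl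
    obtain ⟨hlen, hY, hc⟩ := mem_listWords.1 hl
    rcases l with _ | ⟨a, l⟩
    · simp at hlen
    obtain rfl | ⟨r, b, rfl⟩ := l.eq_nil_or_concat'
    · simp at hlen
      omega
    have hab : a = b := by
      rw [← List.cons_append, List.getLast?_append] at hht
      simpa using hht
    subst hab
    have hrlen : r.length = 2 * n := by
      simp at hlen
      omega
    have hr0 : r ≠ [] := by
      rintro rfl
      simp at hrlen
      omega
    obtain ⟨b, r, rfl⟩ := List.exists_cons_of_ne_nil hr0
    refine ⟨⟨(b :: r).map (·⁻¹), a⁻¹⟩, ?_, by simp⟩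
    simp only [Finset.mem_sigma, closedWords, Finset.mem_filter, mem_invSet, inv_inv,
      map_inv_mem_listWords]
    rw [listProd_cons_of_odd (by
      simp only [List.length_append, hrlen, List.length_singleton]; grind),
      listProd_append_singleton, ← mul_assoc, mul_eq_one_iff_eq_inv, mul_eq_left] at h1
    rw [← List.cons_append, List.isChain_append] at hc
    obtain ⟨hc1, -, hc2⟩ := hc
    refine ⟨⟨mem_listWords.2 ⟨hrlen, fun x hx => hY x ?_, (List.isChain_cons_cons.1 hc1).2⟩, h1⟩,
      hY a (by simp), ?_, ?_⟩
    · simp only [List.mem_cons, List.mem_append] at hx ⊢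
      tauto
    · simpa using (List.isChain_cons_cons.1 hc1).1.symm
    · intro h
      rw [List.getLast?_map, Option.map_eq_some_iff] at h
      obtain ⟨c, hc, hca⟩ := h
      refine hc2 c ?_ a (by simp) (inv_injective hca)
      rw [List.getLast?_cons_cons]
      exact hc

/-- The conjugating letter must avoid both ends of the core. This leaves `q` choices if the ends
agree and `q - 1` if the core is cyclically reduced; the second summand restores the missing choice.
-/
theorem card_acyclicClosedWords_succ_add {Y : Finset Γ} {q : ℕ} (hY : Y.card = q + 1) {n : ℕ}
    (hn : n ≠ 0) :
    (acyclicClosedWords Y (n + 1)).card + (cyclicClosedWords Y n).card =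
      q * (closedWords (invSet Y) n).card := by
  classical
  rw [← card_cyclicClosedWords_invSet, card_acyclicClosedWords_succ Y hn, cyclicClosedWords,
    Finset.card_filter, ← Finset.sum_add_distrib, mul_comm, ← smul_eq_mul, ← Finset.sum_const]
  refine Finset.sum_congr rfl fun l hl => ?_
  simp only [closedWords, Finset.mem_filter] at hl
  obtain ⟨hlen, hmem, -⟩ := mem_listWords.1 hl.1
  have hl0 : l ≠ [] := by
    rintro rfl
    simp at hlen
    omega
  obtain ⟨a, ha⟩ : ∃ a, l.head? = some a := by
    rw [← Option.isSome_iff_exists, List.isSome_head?]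
    simpa using hl0
  obtain ⟨b, hb⟩ : ∃ a, l.getLast? = some a := by
    rw [← Option.isSome_iff_exists, List.getLast?_isSome]
    exact hl0
  have haY : a ∈ invSet Y := hmem a (List.mem_of_mem_head? ha)
  have hbY : b ∈ invSet Y := hmem b (List.mem_of_mem_getLast? hb)
  have hset : ((invSet Y).filter fun x => l.head? ≠ some x ∧ l.getLast? ≠ some x) =
      ((invSet Y).erase a).erase b := by
    ext x
    simp only [ha, hb, Finset.mem_filter, Finset.mem_erase, ne_eq, Option.some.injEq]
    grind
  rw [hset, ha, hb]
  have hc : (invSet Y).card = q + 1 := by rw [card_invSet, hY]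
  by_cases hab : a = b
  · subst hab
    simp [Finset.card_erase_of_mem haY, hc]
  · have : b ∈ (invSet Y).erase a := Finset.mem_erase.2 ⟨Ne.symm hab, hbY⟩
    have hpos : 0 < ((invSet Y).erase a).card := Finset.card_pos.2 ⟨b, this⟩
    rw [Finset.card_erase_of_mem this]
    rw [Finset.card_erase_of_mem haY, hc, Nat.add_sub_cancel] at hpos ⊢
    simp only [ne_eq, Option.some.injEq, hab, not_false_eq_true, if_true]
    omega

theorem closedWords_one (Y : Finset Γ) : closedWords Y 1 = ∅ := by
  classical
  rw [closedWords, Finset.filter_eq_empty_iff]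
  intro l hl h
  obtain ⟨hlen, -, hc⟩ := mem_listWords.1 hl
  obtain ⟨a, b, rfl⟩ := List.length_eq_two.1 hlen
  simp only [listProd, List.length_singleton, List.length_nil] at h
  simp only [List.isChain_cons_cons] at hc
  apply hc.1
  simpa [inv_mul_eq_one] using h

/-- Induction through the preceding recursion for `Y` and for its inverses, the cyclically reduced
counts being equal already. -/
theorem card_acyclicClosedWords_invSet {Y : Finset Γ} {q : ℕ} (hY : Y.card = q + 1) {n : ℕ}
    (hn : 1 ≤ n) :
    (acyclicClosedWords (invSet Y) n).card = (acyclicClosedWords Y n).card := by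
  induction n, hn using Nat.le_induction with
  | base => simp [acyclicClosedWords, closedWords_one]
  | succ n hn ih =>
    have h1 := card_acyclicClosedWords_succ_add hY (n := n) (by omega)
    have h2 := card_acyclicClosedWords_succ_add (Y := invSet Y) (q := q)
      (by rw [card_invSet, hY]) (n := n) (by omega)
    rw [invSet_invSet, card_cyclicClosedWords_invSet, ← card_cyclicClosedWords_add] at h2
    rw [← card_cyclicClosedWords_add, card_cyclicClosedWords_invSet, ih] at h1
    omega

theorem card_closedWords_succ_add {Y : Finset Γ} {q : ℕ} (hY : Y.card = q + 1) {n : ℕ}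
    (hn : 1 ≤ n) :
    (closedWords Y (n + 1)).card + (cyclicClosedWords Y n).card =
      (cyclicClosedWords Y (n + 1)).card + q * (closedWords Y n).card := by
  have h1 := card_acyclicClosedWords_succ_add hY (n := n) (by omega)
  rw [← card_cyclicClosedWords_add, card_cyclicClosedWords_invSet,
    card_acyclicClosedWords_invSet hY hn, card_cyclicClosedWords_add] at h1
  rw [← card_cyclicClosedWords_add Y (n + 1), ← h1]
  omega

open Classical in
/-- Cutting a closed word in the middle gives two distinct words with the same product. -/
theorem card_closedWords_add_le (Y : Finset Γ) (n : ℕ) (hn : n ≠ 0) :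
    (closedWords Y n).card + (listWords Y n).card ≤
      ((listWords Y n ×ˢ listWords Y n).filter fun p => listProd p.1 = listProd p.2).card := by
  rw [← Finset.card_filter_add_card_filter_not (s := (listWords Y n ×ˢ listWords Y n).filter _)
    (fun p => p.1 ≠ p.2)]
  refine add_le_add ?_ ?_
  -- Reversing the first half makes it a word whose inverse product is the first factor. The two
  -- halves differ because their first letters are the neighbours at the cut.
  · refine Finset.card_le_card_of_injOn (fun l => ((l.take n).reverse, l.drop n)) ?_ ?_
    · intro l hl
      simp only [closedWords, Finset.mem_coe, Finset.mem_filter, Finset.mem_product] at hl ⊢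
      obtain ⟨hl, h1⟩ := hl
      obtain ⟨hlen, hY, hc⟩ := mem_listWords.1 hl
      have hA : (l.take n).length = n := by rw [List.length_take]; omega
      have hB : (l.drop n).length = n := by rw [List.length_drop]; omega
      have happ : l.take n ++ l.drop n = l := List.take_append_drop n l
      rw [← happ, List.isChain_append] at hc
      obtain ⟨hcA, hcB, hAB⟩ := hc
      refine ⟨⟨⟨mem_listWords.2 ⟨?_, ?_, ?_⟩, mem_listWords.2 ⟨hB, ?_, hcB⟩⟩, ?_⟩, ?_⟩
      · rw [List.length_reverse, hA]
      · exact fun x hx => hY x (List.mem_of_mem_take (List.mem_reverse.1 hx))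
      · rw [List.isChain_reverse]
        simpa [ne_comm] using hcA
      · exact fun x hx => hY x (List.mem_of_mem_drop hx)
      · rw [← inv_mul_eq_one, inv_listProd_mul_listProd _ _ (by
          rw [List.length_reverse, hA, hB]; exact ⟨n, rfl⟩), List.reverse_reverse, happ, h1]
      · intro h
        have hB0 : l.drop n ≠ [] := by
          rw [← List.length_pos_iff, hB]
          omega
        obtain ⟨b, t, hbt⟩ := List.exists_cons_of_ne_nil hB0
        refine hAB b ?_ b ?_ rfl
        · rw [← List.reverse_reverse (l.take n), h, hbt]
          simp
        · rw [hbt]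
          simp
    · intro l _ l' _ h
      simp only [Prod.mk.injEq, List.reverse_inj] at h
      rw [← List.take_append_drop n l, h.1, h.2, List.take_append_drop]
  · refine Finset.card_le_card_of_injOn (fun l => (l, l)) ?_ ?_
    · intro l hl
      simpa using hl
    · intro l _ l' _ h
      simpa using h

end Counting

/-! ### The regular representation -/

section Regular

variable {Γ : Type*} [Group Γ]

/-- The vector `δ_g` of `ℓ²(Γ)`. -/
def delta (g : Γ) : L2 Γ := leftRegularRep Γ g (deltaOne Γ)

theorem leftRegularRep_apply (g : Γ) (f : L2 Γ) (y : Γ) :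
    (leftRegularRep Γ g f : Γ → ℂ) y = (f : Γ → ℂ) (g⁻¹ * y) := rfl

open Classical in
theorem deltaOne_apply (y : Γ) : (deltaOne Γ : Γ → ℂ) y = if y = 1 then 1 else 0 := by
  rw [deltaOne, lp.single_apply, Pi.single_apply]

open Classical in
theorem delta_apply (g y : Γ) : (delta g : Γ → ℂ) y = if y = g then 1 else 0 := by
  rw [delta, leftRegularRep_apply, deltaOne_apply]
  simp only [inv_mul_eq_one, eq_comm]

theorem inner_deltaOne (f : L2 Γ) : inner ℂ (deltaOne Γ) f = (f : Γ → ℂ) 1 := by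
  classical
  rw [deltaOne, lp.inner_single_left]
  simp

theorem inner_leftRegularRep (g : Γ) (f f' : L2 Γ) :
    inner ℂ (leftRegularRep Γ g f) (leftRegularRep Γ g f') = inner ℂ f f' :=
  (translate g).inner_map_map f f'

theorem inner_delta (g : Γ) (f : L2 Γ) : inner ℂ (delta g) f = (f : Γ → ℂ) g := by
  have h : f = leftRegularRep Γ g (leftRegularRep Γ g⁻¹ f) := by
    rw [← mul_apply_eq_comp, ← map_mul]
    simp
  conv_lhs => rw [h]
  rw [delta, inner_leftRegularRep, inner_deltaOne, leftRegularRep_apply]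
  simp

theorem adjoint_leftRegularRep (g : Γ) :
    ContinuousLinearMap.adjoint (leftRegularRep Γ g) = leftRegularRep Γ g⁻¹ := by
  symm
  rw [ContinuousLinearMap.eq_adjoint_iff]
  intro f f'
  rw [← inner_leftRegularRep g, ← mul_apply_eq_comp, ← map_mul]
  simp

theorem regularRep_of (g : Γ) : regularRep Γ (MonoidAlgebra.of ℂ Γ g) = leftRegularRep Γ g :=
  MonoidAlgebra.lift_of _ _

theorem regularRep_of_deltaOne (g : Γ) :
    regularRep Γ (MonoidAlgebra.of ℂ Γ g) (deltaOne Γ) = delta g := by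
  rw [regularRep_of]
  rfl

theorem regularRep_deltaOne_apply (b : MonoidAlgebra ℂ Γ) (g : Γ) :
    (regularRep Γ b (deltaOne Γ) : Γ → ℂ) g = b.coeff g := by
  classical
  induction b using MonoidAlgebra.induction_on with
  | of x =>
    rw [regularRep_of_deltaOne, delta_apply, MonoidAlgebra.of_apply,
      MonoidAlgebra.coeff_single, Finsupp.single_apply]
    simp only [eq_comm]
  | add x y hx hy =>
    rw [map_add, add_apply, lp.coeFn_add, Pi.add_apply, hx, hy]
    rfl
  | smul r x hx =>
    rw [map_smul, smul_apply, lp.coeFn_smul, Pi.smul_apply, hx]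
    rfl

theorem trace_regularRep (b : MonoidAlgebra ℂ Γ) : trace (regularRep Γ b) = b.coeff 1 := by
  rw [trace, inner_deltaOne, regularRep_deltaOne_apply]

open Classical in
theorem trace_regularRep_sum_of {ι : Type*} (S : Finset ι) (g : ι → Γ) :
    (trace (regularRep Γ (∑ i ∈ S, MonoidAlgebra.of ℂ Γ (g i)))).re =
      ((S.filter fun i => g i = 1).card : ℝ) := by
  rw [trace_regularRep, MonoidAlgebra.coeff_sum, Finsupp.finsetSum_apply]
  simp only [MonoidAlgebra.of_apply, MonoidAlgebra.coeff_single, Finsupp.single_apply]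
  simp

theorem eta_eq_card (Y : Finset Γ) (n : ℕ) : eta Y n = (closedWords Y n).card := by
  classical
  rw [eta, hSeq_eq, trace_regularRep_sum_of, closedWords]

theorem zeta_eq_card (Y : Finset Γ) {n : ℕ} (hn : n ≠ 0) :
    zeta Y n = (cyclicClosedWords Y n).card := by
  classical
  rw [zeta, zSeq_eq Y hn, trace_regularRep_sum_of, cyclicListWords, cyclicClosedWords, closedWords,
    Finset.filter_comm]

theorem twoNorm_eq_norm (b : MonoidAlgebra ℂ Γ) : twoNorm b = ‖regularRep Γ b (deltaOne Γ)‖ := by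
  rw [twoNorm, trace, mul_apply_eq_comp, ContinuousLinearMap.adjoint_inner_right,
    inner_self_eq_norm_sq_to_K]
  norm_cast
  exact Real.sqrt_sq (norm_nonneg _)

theorem norm_deltaOne : ‖deltaOne Γ‖ = 1 := by
  have h := inner_self_eq_norm_sq_to_K (𝕜 := ℂ) (deltaOne Γ)
  rw [inner_deltaOne, deltaOne_apply, if_pos rfl] at h
  have h2 : ‖deltaOne Γ‖ ^ 2 = 1 := by
    rw [← Complex.ofReal_inj]
    push_cast
    exact h.symm
  nlinarith [norm_nonneg (deltaOne Γ)]

theorem twoNorm_le_opNorm (b : MonoidAlgebra ℂ Γ) : twoNorm b ≤ opNorm b := by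
  rw [twoNorm_eq_norm, opNorm]
  simpa [norm_deltaOne] using (regularRep Γ b).le_opNorm (deltaOne Γ)

theorem norm_leftRegularRep_le (g : Γ) : ‖leftRegularRep Γ g‖ ≤ 1 :=
  (translate g).norm_toContinuousLinearMap_le

open Classical in
theorem norm_sum_delta_sq {ι : Type*} (S : Finset ι) (c : ι → ℝ) (g : ι → Γ) :
    ‖∑ i ∈ S, (c i : ℂ) • delta (g i)‖ ^ 2 =
      ∑ i ∈ S, ∑ j ∈ S, if g i = g j then c i * c j else 0 := by
  have h := inner_self_eq_norm_sq_to_K (𝕜 := ℂ) (∑ i ∈ S, (c i : ℂ) • delta (g i))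
  have h2 : (inner ℂ (∑ i ∈ S, (c i : ℂ) • delta (g i)) (∑ i ∈ S, (c i : ℂ) • delta (g i)) : ℂ) =
      ((∑ i ∈ S, ∑ j ∈ S, if g i = g j then c i * c j else 0 : ℝ) : ℂ) := by
    simp only [sum_inner, inner_sum, inner_smul_left, inner_smul_right, inner_delta, delta_apply]
    rw [Complex.ofReal_sum]
    refine Finset.sum_congr rfl fun i _ => ?_
    rw [Complex.ofReal_sum, Finset.mul_sum]
    refine Finset.sum_congr rfl fun j _ => ?_
    by_cases hij : g i = g j
    · simp [hij]
    · simp [hij, Ne.symm hij]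
  rw [h2] at h
  rw [← Complex.ofReal_inj, h]
  exact (Complex.ofReal_pow _ _)

open Classical in
theorem norm_sum_delta_sq_of_injOn {ι : Type*} (S : Finset ι) (c : ι → ℝ) (g : ι → Γ)
    (hg : Set.InjOn g S) :
    ‖∑ i ∈ S, (c i : ℂ) • delta (g i)‖ ^ 2 = ∑ i ∈ S, c i ^ 2 := by
  rw [norm_sum_delta_sq]
  refine Finset.sum_congr rfl fun i hi => ?_
  rw [Finset.sum_eq_single_of_mem i hi]
  · simp [sq]
  · intro j hj hji
    rw [if_neg]
    exact fun h => hji (hg hj hi h.symm)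

theorem regularRep_hSeq_deltaOne (Y : Finset Γ) (n : ℕ) :
    regularRep Γ (hSeq Y n) (deltaOne Γ) = ∑ l ∈ listWords Y n, delta (listProd l) := by
  rw [hSeq_eq, map_sum, sum_apply]
  simp only [regularRep_of_deltaOne]

open Classical in
theorem twoNorm_hSeq_sq (Y : Finset Γ) (n : ℕ) :
    twoNorm (hSeq Y n) ^ 2 = (((listWords Y n ×ˢ listWords Y n).filter
      fun p => listProd p.1 = listProd p.2).card : ℝ) := by
  rw [twoNorm_eq_norm, regularRep_hSeq_deltaOne]
  have h := norm_sum_delta_sq (listWords Y n) (fun _ => 1) listProd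
  simp only [Complex.ofReal_one, one_smul, mul_one] at h
  rw [h, ← Finset.sum_product', Finset.card_filter]
  simp

/-- `‖h_n‖₂²` counts pairs of words with equal product. Subtracting `(q + 1) qⁿ⁻¹` removes the
diagonal, and closed words inject into the remaining pairs. -/
theorem eta_le_xi {Y : Finset Γ} {q : ℕ} (hY : Y.card = q + 1) {n : ℕ} (hn : n ≠ 0) :
    eta Y n ≤ xi Y n := by
  classical
  have h := card_closedWords_add_le Y n hn
  obtain ⟨m, rfl⟩ := Nat.exists_eq_succ_of_ne_zero hn
  rw [Nat.succ_eq_add_one, card_listWords_succ hY] at h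
  rw [xi, twoNorm_hSeq_sq, eta_eq_card, hY, le_sub_iff_add_le]
  push_cast
  rw [add_sub_cancel_right]
  exact_mod_cast h

theorem zeta_le_eta (Y : Finset Γ) {n : ℕ} (hn : n ≠ 0) : zeta Y n ≤ eta Y n := by
  classical
  rw [zeta_eq_card Y hn, eta_eq_card]
  exact_mod_cast Finset.card_filter_le _ _

theorem xi_le_twoNorm_sq {Y : Finset Γ} {q : ℕ} (hY : Y.card = q + 1) (n : ℕ) :
    xi Y n ≤ twoNorm (hSeq Y n) ^ 2 := by
  rw [xi, sub_le_self_iff, hY]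
  push_cast
  rw [add_sub_cancel_right]
  positivity

/-! ### Recursions -/

/-- The parity of `n` decides whether the prepended letter carries an inverse. The exceptional
coefficient at `n = 0` reflects the `q + 1` neighbours of the root of the tree. -/
theorem sumElt_mul_hSeq {Y : Finset Γ} {q : ℕ} (hY : Y.card = q + 1) (n : ℕ) :
    (if Even n then sumElt (invSet Y) else sumElt Y) * hSeq Y (n + 1) =
      hSeq Y (n + 2) + (if n = 0 then q + 1 else q) • hSeq Y n := by
  rw [hSeq_eq, hSeq_eq, hSeq_eq, ← sum_cons_listWords hY n
    (fun l => MonoidAlgebra.of ℂ Γ (listProd l)) (fun l => MonoidAlgebra.of ℂ Γ (listProd l))]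
  · have : (if Even n then sumElt (invSet Y) else sumElt Y) =
        ∑ a ∈ Y, MonoidAlgebra.of ℂ Γ (if Even n then a⁻¹ else a) := by
      split_ifs
      · simp [sumElt, invSet]
      · rfl
    rw [this, Finset.sum_mul_sum]
    refine Finset.sum_congr rfl fun a _ => Finset.sum_congr rfl fun l hl => ?_
    rw [← map_mul, listProd, (mem_listWords.1 hl).1]
    by_cases h : Even n <;> simp [h, Nat.even_add_one]
  · intro a l
    by_cases h : Even l.length <;> simp [listProd, h, Nat.even_add_one]

theorem hSeq_zero (Y : Finset Γ) : hSeq Y 0 = 1 := by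
  rw [hSeq_eq, listWords_zero, Finset.sum_singleton, listProd, map_one]

theorem hSeq_one (Y : Finset Γ) : hSeq Y 1 = sumElt Y := by
  classical
  rw [hSeq_eq, sum_listWords_succ, sumElt]
  refine Finset.sum_congr rfl fun a _ => ?_
  rw [listWords_zero, Finset.filter_true_of_mem (by simp), Finset.sum_singleton]
  simp [listProd]

theorem adjoint_regularRep_sumElt (Y : Finset Γ) :
    ContinuousLinearMap.adjoint (regularRep Γ (sumElt Y)) = regularRep Γ (sumElt (invSet Y)) := by
  simp only [sumElt, invSet, map_sum, Finset.sum_map, regularRep_of, adjoint_leftRegularRep]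
  rfl

/-- The sequence of monic polynomials `T_n` in `x` with `T_n((u + q / u)²) = u²ⁿ + (q / u)²ⁿ`. -/
def cheb {R : Type*} [Ring R] (q : ℕ) (x : R) : ℕ → R
  | 0 => 2
  | 1 => x - 2 * q
  | n + 2 => (x - 2 * q) * cheb q x (n + 1) - q ^ 2 * cheb q x n

theorem map_cheb {R S : Type*} [Ring R] [Ring S] (f : R →+* S) (q : ℕ) (x : R) (n : ℕ) :
    f (cheb q x n) = cheb q (f x) n := by
  induction n using Nat.twoStepInduction with
  | zero => rw [cheb, cheb, map_ofNat]
  | one => rw [cheb, cheb, map_sub, map_mul, map_ofNat, map_natCast]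
  | more n h1 h2 =>
    rw [cheb, cheb, ← h1, ← h2]
    simp only [map_sub, map_mul, map_ofNat, map_natCast, map_pow]

/-- The element `h* h` of the group ring. -/
def square (Y : Finset Γ) : MonoidAlgebra ℂ Γ := sumElt (invSet Y) * sumElt Y

theorem hSeq_two {Y : Finset Γ} {q : ℕ} (hY : Y.card = q + 1) :
    hSeq Y 2 = square Y - (q + 1) := by
  have h := sumElt_mul_hSeq hY 0
  simp only [Even.zero, if_true, hSeq_zero, zero_add, hSeq_one] at h
  rw [square, h]
  simp

theorem hSeq_four {Y : Finset Γ} {q : ℕ} (hY : Y.card = q + 1) :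
    hSeq Y 4 = (square Y - 2 * q) * hSeq Y 2 - q * (q + 1) := by
  have h0 := sumElt_mul_hSeq hY 0
  have h1 := sumElt_mul_hSeq hY 1
  have h2 := sumElt_mul_hSeq hY 2
  simp only [Even.zero, if_true, zero_add, Nat.not_even_one, if_false, one_ne_zero, even_two,
    OfNat.ofNat_ne_zero, nsmul_eq_mul, Nat.reduceAdd, hSeq_zero, hSeq_one] at h0 h1 h2
  have e3 : hSeq Y 3 = sumElt Y * hSeq Y 2 - q * sumElt Y := by rw [h1]; abel
  have hc := Nat.cast_commute q (sumElt (invSet Y))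
  rw [e3, mul_sub, ← mul_assoc, ← mul_assoc, ← hc.eq, mul_assoc (q : MonoidAlgebra ℂ Γ), ← square]
    at h2
  rw [← square] at h0
  rw [← sub_eq_iff_eq_add.2 h2]
  nth_rewrite 2 [h0]
  push_cast
  noncomm_ring

theorem hSeq_add_four {Y : Finset Γ} {q : ℕ} (hY : Y.card = q + 1) {n : ℕ} (hn : n ≠ 0) :
    hSeq Y (2 * n + 4) =
      (square Y - 2 * q) * hSeq Y (2 * n + 2) - q ^ 2 * hSeq Y (2 * n) := by
  have h0 := sumElt_mul_hSeq hY (2 * n)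
  have h1 := sumElt_mul_hSeq hY (2 * n + 1)
  have h2 := sumElt_mul_hSeq hY (2 * n + 2)
  have o1 : ¬ Even (2 * n + 1) := by simp
  have o2 : Even (2 * n + 2) := ⟨n + 1, by omega⟩
  simp only [even_two_mul, if_true, o1, o2, if_false, Nat.mul_eq_zero, OfNat.ofNat_ne_zero, hn,
    Nat.add_eq_zero_iff, one_ne_zero, and_false, or_self,
    nsmul_eq_mul, add_assoc, Nat.reduceAdd] at h0 h1 h2
  have e3 : hSeq Y (2 * n + 3) = sumElt Y * hSeq Y (2 * n + 2) - q * hSeq Y (2 * n + 1) := by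
    rw [h1]; abel
  have hc := Nat.cast_commute q (sumElt (invSet Y))
  rw [e3, mul_sub, ← mul_assoc, ← mul_assoc, ← hc.eq, mul_assoc (q : MonoidAlgebra ℂ Γ), h0] at h2
  rw [← sub_eq_iff_eq_add.2 h2, square]
  noncomm_ring

/-- Both sides satisfy `x_{n+2} = (h*h - 2q) x_{n+1} - q² x_n`, so it suffices to compare two
initial values. The irregular coefficient `q + 1` affects only those. -/
theorem hSeq_sub {Y : Finset Γ} {q : ℕ} (hY : Y.card = q + 1) (n : ℕ) :
    hSeq Y (2 * n + 4) - q * hSeq Y (2 * n + 2) =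
      cheb q (square Y) (n + 2) - cheb q (square Y) (n + 1) := by
  set x := square Y with hx
  have hc : Commute (q : MonoidAlgebra ℂ Γ) x := Nat.cast_commute q x
  have h2 : hSeq Y 2 = x - (q + 1) := hSeq_two hY
  have h4 : hSeq Y 4 = (x - 2 * q) * hSeq Y 2 - q * (q + 1) := hSeq_four hY
  induction n using Nat.twoStepInduction with
  | zero =>
    simp only [mul_zero, zero_add, h4, h2, cheb]
    have := hc.eq
    simp only [mul_sub, sub_mul, mul_add, add_mul, mul_one, mul_two, two_mul, pow_two, this]
    abel
  | one =>
    have h6 : hSeq Y 6 = (x - 2 * q) * hSeq Y 4 - q ^ 2 * hSeq Y 2 :=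
      hSeq_add_four hY one_ne_zero
    simp only [mul_one, Nat.reduceAdd, h6, h4, h2, cheb]
    have := hc.eq
    have h' : ∀ z, (q : MonoidAlgebra ℂ Γ) * (x * z) = x * (q * z) := fun z => by
      rw [← mul_assoc, this, mul_assoc]
    simp only [mul_sub, sub_mul, mul_add, add_mul, mul_assoc, mul_one, mul_two, two_mul,
      pow_two, this, h']
    abel
  | more n ih1 ih2 =>
    have e1 : hSeq Y (2 * (n + 2) + 4) =
        (x - 2 * q) * hSeq Y (2 * (n + 1) + 4) - q ^ 2 * hSeq Y (2 * n + 4) :=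
      hSeq_add_four hY (n := n + 2) (by omega)
    have e2 : hSeq Y (2 * (n + 2) + 2) =
        (x - 2 * q) * hSeq Y (2 * (n + 1) + 2) - q ^ 2 * hSeq Y (2 * n + 2) :=
      hSeq_add_four hY (n := n + 1) (by omega)
    have c1 : cheb q x (n + 2 + 2) - cheb q x (n + 2 + 1) =
        (x - 2 * q) * (cheb q x (n + 1 + 2) - cheb q x (n + 1 + 1)) -
          q ^ 2 * (cheb q x (n + 2) - cheb q x (n + 1)) := by
      rw [show n + 2 + 1 = n + 1 + 2 from rfl, cheb, cheb]
      noncomm_ring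
    rw [c1, ← ih2, ← ih1, e1, e2]
    have hc' : (q : MonoidAlgebra ℂ Γ) * (x - 2 * q) = (x - 2 * q) * q :=
      (Nat.cast_commute q _).eq
    simp only [mul_sub, ← mul_assoc, hc', pow_two]
    abel

end Regular

/-! ### Values of the polynomials `cheb` -/

section Scalar

theorem cheb_add_sq {q : ℕ} {u v : ℝ} (h : u * v = q) (n : ℕ) :
    cheb q ((u + v) ^ 2) n = u ^ (2 * n) + v ^ (2 * n) := by
  induction n using Nat.twoStepInduction with
  | zero => norm_num [cheb]
  | one => rw [cheb, ← h]; ring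
  | more n h1 h2 => rw [cheb, h1, h2, ← h]; ring

/-- Substituting `x - 2q = 2q cos φ` turns the recursion into the cosine addition formula, with
solution `2 qⁿ cos(nφ)`. -/
theorem abs_cheb_le {q : ℕ} {x : ℝ} (hx0 : 0 ≤ x) (hx : x ≤ 4 * q) (n : ℕ) :
    |cheb q x n| ≤ 2 * (q : ℝ) ^ n := by
  obtain ⟨φ, hφ⟩ : ∃ φ : ℝ, x - 2 * q = 2 * q * Real.cos φ := by
    rcases Nat.eq_zero_or_pos q with rfl | hq
    · exact ⟨0, by push_cast at *; linarith⟩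
    · have hq' : (0 : ℝ) < q := by exact_mod_cast hq
      refine ⟨Real.arccos ((x - 2 * q) / (2 * q)), ?_⟩
      rw [Real.cos_arccos]
      · field_simp
      · rw [le_div_iff₀ (by positivity)]; linarith
      · rw [div_le_iff₀ (by positivity)]; linarith
  have key : cheb q x n = 2 * (q : ℝ) ^ n * Real.cos (n * φ) := by
    induction n using Nat.twoStepInduction with
    | zero => simp [cheb]
    | one => simp [cheb, hφ]
    | more n h1 h2 =>
      rw [cheb, h1, h2, hφ]
      have e1 : ((n + 2 : ℕ) : ℝ) * φ = (n + 1 : ℕ) * φ + φ := by push_cast; ring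
      have e2 : (n : ℝ) * φ = (n + 1 : ℕ) * φ - φ := by push_cast; ring
      rw [e1, e2, Real.cos_add, Real.cos_sub]
      ring
  rw [key, abs_mul, abs_of_nonneg (by positivity)]
  exact mul_le_of_le_one_right (by positivity) (Real.abs_cos_le_one _)

/-- The larger solution `u` of `(u + q / u)² = x`. -/
def outer (q : ℕ) (x : ℝ) : ℝ := (√x + √(x - 4 * q)) / 2

theorem outer_mono (q : ℕ) {x y : ℝ} (h : x ≤ y) : outer q x ≤ outer q y := by
  have h1 := Real.sqrt_le_sqrt h
  have h2 : √(x - 4 * q) ≤ √(y - 4 * q) := Real.sqrt_le_sqrt (by linarith)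
  unfold outer
  linarith

theorem continuous_outer (q : ℕ) : Continuous (outer q) := by
  unfold outer
  fun_prop

theorem outer_nonneg (q : ℕ) (x : ℝ) : 0 ≤ outer q x := by
  unfold outer
  positivity

theorem outer_four_mul (q : ℕ) : outer q (4 * q) = √q := by
  rw [outer, sub_self, Real.sqrt_zero, add_zero, Real.sqrt_mul (by norm_num),
    show (4 : ℝ) = 2 ^ 2 by norm_num, Real.sqrt_sq (by norm_num)]
  ring

theorem cheb_eq_outer {q : ℕ} {x : ℝ} (hx : 4 * q ≤ x) :
    ∃ v, 0 ≤ v ∧ v ≤ outer q x ∧ outer q x * v = q ∧ outer q x + v = √x ∧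
      ∀ n, cheb q x n = outer q x ^ (2 * n) + v ^ (2 * n) := by
  have hq : (0 : ℝ) ≤ q := Nat.cast_nonneg q
  have hx0 : 0 ≤ x := by linarith
  have hs : √(x - 4 * q) ≤ √x := Real.sqrt_le_sqrt (by linarith)
  have h1 := Real.sq_sqrt hx0
  have h2 := Real.sq_sqrt (show 0 ≤ x - 4 * q by linarith)
  have h3 := Real.sqrt_nonneg (x - 4 * q)
  have hmul : outer q x * ((√x - √(x - 4 * q)) / 2) = q := by
    unfold outer
    nlinarith
  have hadd : outer q x + (√x - √(x - 4 * q)) / 2 = √x := by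
    unfold outer
    ring
  refine ⟨(√x - √(x - 4 * q)) / 2, by linarith, by unfold outer; linarith, hmul, hadd, ?_⟩
  intro n
  rw [← cheb_add_sq hmul, hadd, h1]

/-- Below `4q` the oscillating bound `2qⁿ` suffices, because `outer q M ≥ √q`; above `4q` both roots
are at most `outer q x ≤ outer q M`. -/
theorem abs_cheb_le_outer {q : ℕ} {x M : ℝ} (hM : 4 * q ≤ M) (hx0 : 0 ≤ x) (hx : x ≤ M) (n : ℕ) :
    |cheb q x n| ≤ 2 * outer q M ^ (2 * n) := by
  rcases le_total x (4 * q) with h | h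
  · refine (abs_cheb_le hx0 h n).trans ?_
    have h1 : √q ≤ outer q M := by
      rw [← outer_four_mul]
      exact outer_mono q hM
    have h2 : (q : ℝ) ^ n = √q ^ (2 * n) := by
      rw [pow_mul, Real.sq_sqrt (Nat.cast_nonneg q)]
    rw [h2]
    gcongr
  · obtain ⟨v, hv0, hv, -, -, hc⟩ := cheb_eq_outer h
    have h0 := outer_nonneg q x
    rw [hc, abs_of_nonneg (by positivity), two_mul (outer q M ^ (2 * n))]
    have hxM := outer_mono q hx
    exact add_le_add (pow_le_pow_left₀ h0 hxM _) (pow_le_pow_left₀ hv0 (hv.trans hxM) _)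

theorem outer_pow_le_cheb {q : ℕ} {x r : ℝ} (hr : 4 * q ≤ r) (hx : r ≤ x) (n : ℕ) :
    outer q r ^ (2 * n) ≤ cheb q x n := by
  obtain ⟨v, hv0, -, -, -, hc⟩ := cheb_eq_outer (hr.trans hx)
  have h0 := outer_nonneg q r
  have hxM := outer_mono q hx
  rw [hc]
  have : outer q r ^ (2 * n) ≤ outer q x ^ (2 * n) := by gcongr
  have : 0 ≤ v ^ (2 * n) := by positivity
  linarith

end Scalar

/-! ### Spectral estimates -/

section Spectral

variable {H : Type*} [NormedAddCommGroup H] [InnerProductSpace ℂ H] [CompleteSpace H]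

theorem mem_Icc_of_mem_spectrum {a : H →L[ℂ] H} (ha : 0 ≤ a) {x : ℝ} (hx : x ∈ spectrum ℝ a) :
    x ∈ Set.Icc 0 ‖a‖ := by
  have h0 : 0 ≤ x := spectrum_nonneg_of_nonneg ha hx
  refine ⟨h0, ?_⟩
  have : Nontrivial (H →L[ℂ] H) := by
    by_contra h
    rw [not_nontrivial_iff_subsingleton] at h
    simp [spectrum.of_subsingleton] at hx
  simpa [abs_of_nonneg h0] using spectrum.norm_le_norm_of_mem hx

theorem norm_aeval_le {a : H →L[ℂ] H} (ha : 0 ≤ a) (p : Polynomial ℝ) {C : ℝ} (hC : 0 ≤ C)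
    (h : ∀ x ∈ Set.Icc 0 ‖a‖, |p.eval x| ≤ C) : ‖Polynomial.aeval a p‖ ≤ C := by
  have hsa : IsSelfAdjoint a := IsSelfAdjoint.of_nonneg ha
  rw [← cfc_polynomial p a hsa]
  exact norm_cfc_le hC fun x hx => h x (mem_Icc_of_mem_spectrum ha hx)

theorem cfc_add_sub_mul_sq {a : H →L[ℂ] H} (ha : IsSelfAdjoint a) (p : Polynomial ℝ) (α β : ℝ)
    {k : ℝ → ℝ} (hk : Continuous k) :
    cfc (fun x => p.eval x + α - β * (k x * k x)) a =
      Polynomial.aeval a p + algebraMap ℝ (H →L[ℂ] H) α -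
        algebraMap ℝ (H →L[ℂ] H) β * (cfc k a * cfc k a) := by
  have hp : ContinuousOn (fun x : ℝ => p.eval x) (spectrum ℝ a) := p.continuous.continuousOn
  have hk' : ContinuousOn k (spectrum ℝ a) := hk.continuousOn
  have hc : ∀ c : ℝ, ContinuousOn (fun _ : ℝ => c) (spectrum ℝ a) := fun c => continuousOn_const
  rw [cfc_sub (fun x => p.eval x + α) (fun x => β * (k x * k x)) a (hp.add (hc α))
      ((hc β).mul (hk'.mul hk')),
    cfc_add a (fun x => p.eval x) (fun _ => α) hp (hc α), cfc_polynomial p a ha, cfc_const α a ha,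
    cfc_mul (fun _ => β) (fun x => k x * k x) a (hc β) (hk'.mul hk'), cfc_const β a ha,
    cfc_mul k k a hk' hk']

/-- Lower bounds for `⟨δ, p(a) δ⟩` if `δ` is separating for the algebra generated by `a`. -/
theorem exists_le_inner_aeval {a : H →L[ℂ] H} (ha : 0 ≤ a) {δ : H} (hδ : δ ≠ 0)
    (hsep : ∀ T : H →L[ℂ] H, IsSelfAdjoint T → (∀ S, Commute a S → Commute T S) →
      T δ = 0 → T = 0) {r : ℝ} (hr : r < ‖a‖) :
    ∃ c : ℝ, 0 < c ∧ ∀ (p : Polynomial ℝ) (α β : ℝ), 0 ≤ α → 0 ≤ β →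
      (∀ x, r ≤ x → β ≤ p.eval x) → (∀ x ∈ Set.Icc 0 ‖a‖, -α ≤ p.eval x) →
      c * β - α * ‖δ‖ ^ 2 ≤ (inner ℂ δ (Polynomial.aeval a p δ)).re := by
  have hsa : IsSelfAdjoint a := IsSelfAdjoint.of_nonneg ha
  have : Nontrivial H := ⟨δ, 0, hδ⟩
  have hpos : 0 < ‖a‖ - r := by linarith
  -- A ramp supported to the right of `r` with value `1` at `‖a‖`. As `‖a‖` lies in the spectrum, `B
  -- = k(a)` is nonzero, and separation gives `B δ ≠ 0`.
  obtain ⟨k, hkc, hk0, hk1, hkr, hka⟩ : ∃ k : ℝ → ℝ, Continuous k ∧ (∀ x, 0 ≤ k x) ∧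
      (∀ x ≤ ‖a‖, k x ≤ 1) ∧ (∀ x ≤ r, k x = 0) ∧ k ‖a‖ = 1 := by
    refine ⟨fun x => max 0 ((x - r) / (‖a‖ - r)), by fun_prop, fun x => le_max_left _ _,
      fun x hx => max_le zero_le_one ((div_le_one hpos).2 (by linarith)),
      fun x hx => max_eq_left (div_nonpos_of_nonpos_of_nonneg (by linarith) hpos.le), ?_⟩
    simp [div_self hpos.ne']
  obtain ⟨B, hB⟩ : ∃ B : H →L[ℂ] H, B = cfc k a := ⟨_, rfl⟩
  have hBsa : IsSelfAdjoint B := hB ▸ cfc_predicate k a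
  have hBne : B ≠ 0 := by
    intro h0
    have h1 : k ‖a‖ ∈ spectrum ℝ B := by
      rw [hB, cfc_map_spectrum (R := ℝ) k a hsa hkc.continuousOn]
      exact ⟨_, CStarAlgebra.norm_mem_spectrum_of_nonneg ha, rfl⟩
    rw [h0, spectrum.zero_eq, hka] at h1
    simp at h1
  have hBδ : B δ ≠ 0 := fun h => hBne (hsep B hBsa (fun S hS => hB ▸ hS.cfc_real k) h)
  refine ⟨‖B δ‖ ^ 2, by positivity, fun p α β hα hβ h1 h2 => ?_⟩
  -- On the spectrum `p + α ≥ β k²`: left of `r` the ramp vanishes, right of it `p ≥ β` and `k ≤ 1`.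
  -- Evaluating at `δ` gives the bound with `c = ‖B δ‖²`.
  have hT : 0 ≤ cfc (fun x => p.eval x + α - β * (k x * k x)) a := by
    refine cfc_nonneg fun x hx => ?_
    obtain ⟨hx0, hxa⟩ := mem_Icc_of_mem_spectrum ha hx
    rcases le_total x r with hxr | hxr
    · rw [hkr x hxr]
      have := h2 x ⟨hx0, hxa⟩
      linarith
    · have h3 := h1 x hxr
      have h4 := mul_le_one₀ (hk1 x hxa) (hk0 x) (hk1 x hxa)
      nlinarith
  rw [cfc_add_sub_mul_sq hsa p α β hkc, ← hB, ContinuousLinearMap.nonneg_iff_isPositive] at hT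
  have h := (Complex.le_def.1 (hT.inner_nonneg_right δ)).1
  have e1 : algebraMap ℝ (H →L[ℂ] H) α δ = (α : ℂ) • δ := by
    rw [Algebra.algebraMap_eq_smul_one]
    rfl
  have e2 : (algebraMap ℝ (H →L[ℂ] H) β * (B * B)) δ = (β : ℂ) • B (B δ) := by
    rw [Algebra.algebraMap_eq_smul_one, smul_mul_assoc, one_mul]
    rfl
  have e3 : inner ℂ δ (B (B δ)) = ((‖B δ‖ ^ 2 : ℝ) : ℂ) := by
    rw [← ContinuousLinearMap.adjoint_inner_left, hBsa.adjoint_eq, inner_self_eq_norm_sq_to_K]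
    exact (Complex.ofReal_pow _ _).symm
  have e4 : inner ℂ δ δ = ((‖δ‖ ^ 2 : ℝ) : ℂ) := by
    rw [inner_self_eq_norm_sq_to_K]
    exact (Complex.ofReal_pow _ _).symm
  rw [sub_apply, add_apply, e1, e2, inner_sub_right, inner_add_right, inner_smul_right,
    inner_smul_right, e3, e4, ← Complex.ofReal_mul, ← Complex.ofReal_mul, Complex.sub_re,
    Complex.add_re, Complex.ofReal_re, Complex.ofReal_re, Complex.zero_re] at h
  linarith

theorem aeval_cheb (q : ℕ) (a : H →L[ℂ] H) (n : ℕ) :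
    Polynomial.aeval a (cheb q (Polynomial.X : Polynomial ℝ) n) = cheb q a n := by
  have := map_cheb (Polynomial.aeval a : Polynomial ℝ →ₐ[ℝ] (H →L[ℂ] H)).toRingHom q
    Polynomial.X n
  simpa using this

theorem eval_cheb (q : ℕ) (x : ℝ) (n : ℕ) :
    (cheb q (Polynomial.X : Polynomial ℝ) n).eval x = cheb q x n := by
  simpa using map_cheb (Polynomial.evalRingHom x) q Polynomial.X n

theorem norm_cheb_le {q : ℕ} {a : H →L[ℂ] H} (ha : 0 ≤ a) (hM : 4 * q ≤ ‖a‖) (n : ℕ) :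
    ‖cheb q a n‖ ≤ 2 * outer q ‖a‖ ^ (2 * n) := by
  rw [← aeval_cheb]
  have h0 := outer_nonneg q ‖a‖
  refine norm_aeval_le ha _ (by positivity) fun x hx => ?_
  rw [eval_cheb]
  exact abs_cheb_le_outer hM hx.1 hx.2 n

theorem exists_le_inner_cheb {q : ℕ} {a : H →L[ℂ] H} (ha : 0 ≤ a) {δ : H} (hδ : ‖δ‖ = 1)
    (hsep : ∀ T : H →L[ℂ] H, IsSelfAdjoint T → (∀ S, Commute a S → Commute T S) →
      T δ = 0 → T = 0) {r : ℝ} (hr0 : 4 * q ≤ r) (hr : r < ‖a‖) :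
    ∃ c : ℝ, 0 < c ∧ ∀ n,
      c * outer q r ^ (2 * n) - 2 * (q : ℝ) ^ n ≤ (inner ℂ δ (cheb q a n δ)).re := by
  obtain ⟨c, hc, h⟩ := exists_le_inner_aeval ha (norm_ne_zero_iff.1 (hδ ▸ one_ne_zero)) hsep hr
  refine ⟨c, hc, fun n => ?_⟩
  have h0 := outer_nonneg q r
  have := h (cheb q Polynomial.X n) (2 * (q : ℝ) ^ n) (outer q r ^ (2 * n)) (by positivity)
    (by positivity) (fun x hx => ?_) (fun x hx => ?_)
  · rwa [hδ, one_pow, mul_one, aeval_cheb] at this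
  · rw [eval_cheb]
    exact outer_pow_le_cheb hr0 hx n
  · rw [eval_cheb]
    rcases le_total x (4 * q) with hxq | hxq
    · exact (abs_le.1 (abs_cheb_le hx.1 hxq n)).1
    · have h1 := outer_pow_le_cheb le_rfl hxq n
      have h2 := outer_nonneg q (4 * q)
      have h3 : 0 ≤ outer q (4 * q) ^ (2 * n) := by positivity
      have h4 : (0 : ℝ) ≤ (q : ℝ) ^ n := by positivity
      linarith

theorem exists_le_inner_pow {a : H →L[ℂ] H} (ha : 0 ≤ a) {δ : H} (hδ : δ ≠ 0)
    (hsep : ∀ T : H →L[ℂ] H, IsSelfAdjoint T → (∀ S, Commute a S → Commute T S) →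
      T δ = 0 → T = 0) {r : ℝ} (hr0 : 0 ≤ r) (hr : r < ‖a‖) :
    ∃ c : ℝ, 0 < c ∧ ∀ n : ℕ, c * r ^ n ≤ (inner ℂ δ ((a ^ n) δ)).re := by
  obtain ⟨c, hc, h⟩ := exists_le_inner_aeval ha hδ hsep hr
  refine ⟨c, hc, fun n => ?_⟩
  have := h (Polynomial.X ^ n) 0 (r ^ n) le_rfl (by positivity) (fun x hx => ?_) (fun x hx => ?_)
  · simpa using this
  · rw [Polynomial.eval_pow, Polynomial.eval_X]
    gcongr
  · rw [Polynomial.eval_pow, Polynomial.eval_X, neg_zero]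
    have := hx.1
    positivity

end Spectral

/-! ### Estimates for the group ring -/

section Estimates

variable {Γ : Type*} [Group Γ]

theorem memℓp_rightTranslate (x : Γ) (f : L2 Γ) :
    Memℓp (fun y : Γ => (f : Γ → ℂ) (y * x)) 2 := by
  have hp : 0 < (2 : ENNReal).toReal := by norm_num
  have hf := (memℓp_gen_iff hp).1 (lp.memℓp f)
  exact (memℓp_gen_iff hp).2 ((Equiv.mulRight x).summable_iff.2 hf)

/-- The isometry of `ℓ²(Γ)` given by right translation. -/
def rightTranslate (x : Γ) : L2 Γ →ₗᵢ[ℂ] L2 Γ where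
  toFun f := ⟨fun y => (f : Γ → ℂ) (y * x), memℓp_rightTranslate x f⟩
  map_add' _ _ := rfl
  map_smul' _ _ := rfl
  norm_map' f := by
    have hp : 0 < (2 : ENNReal).toReal := by norm_num
    rw [lp.norm_eq_tsum_rpow hp, lp.norm_eq_tsum_rpow hp]
    congr 1
    exact (Equiv.mulRight x).tsum_eq (fun y => ‖(f : Γ → ℂ) y‖ ^ (2 : ENNReal).toReal)

theorem rightTranslate_deltaOne (x : Γ) : rightTranslate x⁻¹ (deltaOne Γ) = delta x := by
  classical
  ext y
  change (deltaOne Γ : Γ → ℂ) (y * x⁻¹) = _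
  rw [deltaOne_apply, delta_apply]
  simp only [mul_inv_eq_one]

theorem commute_rightTranslate (b : MonoidAlgebra ℂ Γ) (x : Γ) :
    Commute (regularRep Γ b) (rightTranslate x).toContinuousLinearMap := by
  induction b using MonoidAlgebra.induction_on with
  | of g =>
    rw [regularRep_of]
    ext f y
    change (f : Γ → ℂ) (g⁻¹ * y * x) = (f : Γ → ℂ) (g⁻¹ * (y * x))
    rw [mul_assoc]
  | add b c hb hc =>
    rw [map_add]
    exact hb.add_left hc
  | smul r b hb =>
    rw [map_smul]
    exact hb.smul_left r

/-- The vector `δ_e` is separating for the bicommutant of an element of the group ring. -/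
theorem deltaOne_separating (b : MonoidAlgebra ℂ Γ) (T : L2 Γ →L[ℂ] L2 Γ) (hT : IsSelfAdjoint T)
    (hcomm : ∀ S, Commute (regularRep Γ b) S → Commute T S) (h0 : T (deltaOne Γ) = 0) : T = 0 := by
  -- `T` commutes with right translations, which carry `δ_e` to every `δ_g`. Self-adjointness then
  -- makes every coefficient `⟨δ_g, T f⟩` vanish.
  have h1 : ∀ g : Γ, T (delta g) = 0 := by
    intro g
    have h := congrArg (fun S : L2 Γ →L[ℂ] L2 Γ => S (deltaOne Γ))
      (hcomm _ (commute_rightTranslate b g⁻¹)).eq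
    simp only [mul_apply_eq_comp, h0, map_zero] at h
    rw [← rightTranslate_deltaOne]
    exact h
  ext f g
  rw [← inner_delta, ← ContinuousLinearMap.adjoint_inner_left, hT.adjoint_eq, h1]
  simp

theorem regularRep_square (Y : Finset Γ) :
    regularRep Γ (square Y) = star (regularRep Γ (sumElt Y)) * regularRep Γ (sumElt Y) := by
  rw [ContinuousLinearMap.star_eq_adjoint, adjoint_regularRep_sumElt, square, map_mul]

theorem regularRep_square_nonneg (Y : Finset Γ) : 0 ≤ regularRep Γ (square Y) := by
  rw [regularRep_square]
  exact star_mul_self_nonneg _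

theorem norm_regularRep_square (Y : Finset Γ) :
    ‖regularRep Γ (square Y)‖ = opNorm (sumElt Y) ^ 2 := by
  rw [regularRep_square, ContinuousLinearMap.star_eq_adjoint, opNorm, sq]
  exact ContinuousLinearMap.norm_adjoint_comp_self _

theorem regularRep_cheb (q : ℕ) (b : MonoidAlgebra ℂ Γ) (n : ℕ) :
    regularRep Γ (cheb q b n) = cheb q (regularRep Γ b) n :=
  map_cheb (regularRep Γ).toRingHom q b n

theorem opNorm_nonneg (b : MonoidAlgebra ℂ Γ) : 0 ≤ opNorm b := norm_nonneg _

theorem opNorm_add_le (b c : MonoidAlgebra ℂ Γ) : opNorm (b + c) ≤ opNorm b + opNorm c := by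
  rw [opNorm, map_add]
  exact norm_add_le _ _

theorem opNorm_sub_le (b c : MonoidAlgebra ℂ Γ) : opNorm (b - c) ≤ opNorm b + opNorm c := by
  rw [opNorm, map_sub]
  exact norm_sub_le _ _

theorem opNorm_mul_le (b c : MonoidAlgebra ℂ Γ) : opNorm (b * c) ≤ opNorm b * opNorm c := by
  rw [opNorm, map_mul]
  exact norm_mul_le _ _

theorem opNorm_one_le : opNorm (1 : MonoidAlgebra ℂ Γ) ≤ 1 := by
  rw [opNorm, map_one]
  exact ContinuousLinearMap.norm_id_le

theorem opNorm_natCast_le (q : ℕ) : opNorm (q : MonoidAlgebra ℂ Γ) ≤ q := by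
  induction q with
  | zero => simp [opNorm]
  | succ q ih =>
    push_cast
    exact (opNorm_add_le _ _).trans (add_le_add ih opNorm_one_le)

theorem opNorm_natCast_mul_le (q : ℕ) (b : MonoidAlgebra ℂ Γ) :
    opNorm ((q : MonoidAlgebra ℂ Γ) * b) ≤ q * opNorm b :=
  (opNorm_mul_le _ _).trans (mul_le_mul_of_nonneg_right (opNorm_natCast_le q) (opNorm_nonneg b))

theorem opNorm_sumElt_le (Y : Finset Γ) : opNorm (sumElt Y) ≤ Y.card := by
  rw [opNorm, sumElt, map_sum]
  refine (norm_sum_le _ _).trans ?_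
  rw [Finset.card_eq_sum_ones]
  push_cast
  refine Finset.sum_le_sum fun g _ => ?_
  rw [regularRep_of]
  exact norm_leftRegularRep_le g

variable {Y : Finset Γ} {q : ℕ}

theorem opNorm_cheb_le (hN : 4 * q ≤ opNorm (sumElt Y) ^ 2) (n : ℕ) :
    opNorm (cheb q (square Y) n) ≤ 2 * outer q (opNorm (sumElt Y) ^ 2) ^ (2 * n) := by
  rw [opNorm, regularRep_cheb, ← norm_regularRep_square]
  exact norm_cheb_le (regularRep_square_nonneg Y) (by rwa [norm_regularRep_square]) n

theorem natCast_le_outer_sq {M : ℝ} (hM : 4 * q ≤ M) : (q : ℝ) ≤ outer q M ^ 2 := by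
  have h : √q ≤ outer q M := by
    rw [← outer_four_mul]
    exact outer_mono q hM
  calc (q : ℝ) = √q ^ 2 := (Real.sq_sqrt (Nat.cast_nonneg q)).symm
    _ ≤ _ := by gcongr

theorem one_le_outer (hq : 1 ≤ q) {M : ℝ} (hM : 4 * q ≤ M) : 1 ≤ outer q M := by
  have h1 := natCast_le_outer_sq hM
  have h2 : (1 : ℝ) ≤ q := by exact_mod_cast hq
  have h3 := outer_nonneg q M
  nlinarith

/-- With `q ≤ γ²` and `γ ≥ 1`, each step of `hSeq_sub` multiplies the old bound by at most `γ²` and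
adds two Chebyshev terms, at most `4γ²ⁿ` together. Hence the factor `4n + 1`. -/
theorem opNorm_hSeq_even_le (hq : 1 ≤ q) (hY : Y.card = q + 1)
    (hN : 4 * q ≤ opNorm (sumElt Y) ^ 2) (n : ℕ) :
    opNorm (hSeq Y (2 * n)) ≤ (4 * n + 1) * outer q (opNorm (sumElt Y) ^ 2) ^ (2 * n) := by
  have hcheb := opNorm_cheb_le hN
  have hγ := natCast_le_outer_sq hN
  have h1 := one_le_outer hq hN
  set γ := outer q (opNorm (sumElt Y) ^ 2)
  have hq1 : (1 : ℝ) ≤ q := by exact_mod_cast hq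
  rcases n with _ | n
  · simpa [hSeq_zero] using opNorm_one_le (Γ := Γ)
  induction n with
  | zero =>
    have e : hSeq Y (2 * (0 + 1)) = cheb q (square Y) 1 + ((q - 1 : ℕ) : MonoidAlgebra ℂ Γ) := by
      rw [Nat.cast_sub hq]
      simp only [zero_add, mul_one, hSeq_two hY, cheb, two_mul]
      push_cast
      abel
    rw [e]
    refine (opNorm_add_le _ _).trans ?_
    have h2 := opNorm_natCast_le (Γ := Γ) (q - 1)
    have h3 := hcheb 1
    have h4 : ((q - 1 : ℕ) : ℝ) = q - 1 := by rw [Nat.cast_sub hq, Nat.cast_one]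
    rw [h4] at h2
    norm_num at h3 ⊢
    linarith
  | succ n ih =>
    have e : hSeq Y (2 * (n + 1 + 1)) = q * hSeq Y (2 * (n + 1)) +
        (cheb q (square Y) (n + 2) - cheb q (square Y) (n + 1)) := by
      rw [← hSeq_sub hY]
      simp only [show 2 * (n + 1 + 1) = 2 * n + 4 by ring, show 2 * (n + 1) = 2 * n + 2 by ring]
      abel
    rw [e]
    refine (opNorm_add_le _ _).trans ?_
    have h2 := (opNorm_natCast_mul_le q (hSeq Y (2 * (n + 1)))).trans
      (mul_le_mul hγ ih (opNorm_nonneg _) (by positivity))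
    have h3 := (opNorm_sub_le (cheb q (square Y) (n + 2)) (cheb q (square Y) (n + 1))).trans
      (add_le_add (hcheb (n + 2)) (hcheb (n + 1)))
    have h4 : γ ^ (2 * (n + 1)) ≤ γ ^ (2 * (n + 2)) :=
      pow_le_pow_right₀ h1 (by omega)
    have h5 : γ ^ 2 * γ ^ (2 * (n + 1)) = γ ^ (2 * (n + 2)) := by ring
    push_cast at *
    rw [show n + 1 + 1 = n + 2 by ring]
    have h6 : γ ^ 2 * ((4 * ((n : ℝ) + 1) + 1) * γ ^ (2 * (n + 1))) =
      (4 * ((n : ℝ) + 1) + 1) * γ ^ (2 * (n + 2)) := by rw [← h5]; ring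
    rw [h6] at h2
    linarith

theorem opNorm_sumElt_le_outer : opNorm (sumElt Y) ≤ 2 * outer q (opNorm (sumElt Y) ^ 2) := by
  rw [outer, Real.sqrt_sq (opNorm_nonneg _)]
  have := Real.sqrt_nonneg (opNorm (sumElt Y) ^ 2 - 4 * q)
  linarith

theorem opNorm_hSeq_odd_le (hq : 1 ≤ q) (hY : Y.card = q + 1)
    (hN : 4 * q ≤ opNorm (sumElt Y) ^ 2) (n : ℕ) :
    opNorm (hSeq Y (2 * n + 1)) ≤
      (n + 1) * (8 * n + 2) * outer q (opNorm (sumElt Y) ^ 2) ^ (2 * n + 1) := by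
  have heven := opNorm_hSeq_even_le hq hY hN
  have hγ := natCast_le_outer_sq hN
  have h1 := one_le_outer hq hN
  have hle := opNorm_sumElt_le_outer (Y := Y) (q := q)
  set γ := outer q (opNorm (sumElt Y) ^ 2)
  induction n with
  | zero => simpa [hSeq_one] using hle
  | succ n ih =>
    have h := sumElt_mul_hSeq hY (2 * n + 1)
    rw [if_neg (by simp), if_neg (by omega), nsmul_eq_mul] at h
    have e : hSeq Y (2 * (n + 1) + 1) =
        sumElt Y * hSeq Y (2 * (n + 1)) - q * hSeq Y (2 * n + 1) := by
      rw [eq_sub_iff_add_eq]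
      exact h.symm
    rw [e]
    refine (opNorm_sub_le _ _).trans ?_
    have h2 := (opNorm_natCast_mul_le q (hSeq Y (2 * n + 1))).trans
      (mul_le_mul hγ ih (opNorm_nonneg _) (by positivity))
    have h3 := (opNorm_mul_le (sumElt Y) (hSeq Y (2 * (n + 1)))).trans
      (mul_le_mul hle (heven (n + 1)) (opNorm_nonneg _) (by positivity))
    have h6 : γ ^ 2 * (((n : ℝ) + 1) * (8 * n + 2) * γ ^ (2 * n + 1)) =
      (((n : ℝ) + 1) * (8 * n + 2)) * γ ^ (2 * (n + 1) + 1) := by ring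
    have h7 : 2 * γ * ((4 * ((n + 1 : ℕ) : ℝ) + 1) * γ ^ (2 * (n + 1))) =
      (8 * (n : ℝ) + 10) * γ ^ (2 * (n + 1) + 1) := by push_cast; ring
    rw [h6] at h2
    rw [h7] at h3
    have h8 : 0 ≤ γ ^ (2 * (n + 1) + 1) := by positivity
    have h9 : (0 : ℝ) ≤ n := Nat.cast_nonneg n
    refine (add_le_add h3 h2).trans ?_
    rw [← add_mul]
    refine mul_le_mul_of_nonneg_right ?_ h8
    push_cast
    nlinarith

theorem twoNorm_hSeq_sq_le (hq : 1 ≤ q) (hY : Y.card = q + 1)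
    (hN : 4 * q ≤ opNorm (sumElt Y) ^ 2) (n : ℕ) :
    twoNorm (hSeq Y n) ^ 2 ≤
      16 * ((n : ℝ) + 1) ^ 4 * outer q (opNorm (sumElt Y) ^ 2) ^ (2 * n) := by
  have h0 := outer_nonneg q (opNorm (sumElt Y) ^ 2)
  have key : opNorm (hSeq Y n) ≤ 4 * ((n : ℝ) + 1) ^ 2 * outer q (opNorm (sumElt Y) ^ 2) ^ n := by
    rcases Nat.even_or_odd' n with ⟨k, rfl | rfl⟩
    · refine (opNorm_hSeq_even_le hq hY hN k).trans (mul_le_mul_of_nonneg_right ?_ (by positivity))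
      push_cast
      nlinarith [Nat.cast_nonneg (α := ℝ) k]
    · refine (opNorm_hSeq_odd_le hq hY hN k).trans (mul_le_mul_of_nonneg_right ?_ (by positivity))
      push_cast
      nlinarith [Nat.cast_nonneg (α := ℝ) k]
  have h1 : 0 ≤ twoNorm (hSeq Y n) := Real.sqrt_nonneg _
  calc twoNorm (hSeq Y n) ^ 2
      ≤ (4 * ((n : ℝ) + 1) ^ 2 * outer q (opNorm (sumElt Y) ^ 2) ^ n) ^ 2 := by
        gcongr
        exact (twoNorm_le_opNorm _).trans key
    _ = _ := by ring

/-! ### The trace of `z_n` -/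

/-- The counting identity gives `ζ_{n+2} - ζ_{n+1} = η_{n+2} - q η_{n+1}`, and by `hSeq_sub` this is
the increment of `τ(T_n(h*h))`. The constant comes from `ζ_1 = 0` and `T_1(h*h) = h_2 - (q - 1)`. -/
theorem zeta_eq_trace (hq : 1 ≤ q) (hY : Y.card = q + 1) (n : ℕ) :
    zeta Y (n + 1) = (trace (regularRep Γ (cheb q (square Y) (n + 1)))).re + (q - 1) := by
  induction n with
  | zero =>
    have h1 : eta Y 1 = 0 := by rw [eta_eq_card, closedWords_one]; simp
    have h2 : zeta Y 1 = 0 := by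
      rw [zeta_eq_card Y one_ne_zero, cyclicClosedWords, closedWords_one]; simp
    have e : cheb q (square Y) 1 = hSeq Y (2 * 1) - ((q - 1 : ℕ) : MonoidAlgebra ℂ Γ) := by
      rw [Nat.cast_sub hq, mul_one, hSeq_two hY, cheb, two_mul]
      push_cast
      abel
    rw [eta] at h1
    rw [zero_add, h2, e, trace_regularRep, MonoidAlgebra.coeff_sub, Finsupp.sub_apply,
      Complex.sub_re, ← trace_regularRep, h1, MonoidAlgebra.coeff_natCast]
    simp [Nat.cast_sub hq]
  | succ n ih =>
    have h := congrArg (fun b => (trace (regularRep Γ b)).re) (hSeq_sub hY n)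
    have hq' : regularRep Γ (q * hSeq Y (2 * n + 2)) =
        (q : ℂ) • regularRep Γ (hSeq Y (2 * n + 2)) := by
      rw [map_mul, map_natCast, ← nsmul_eq_mul, Nat.cast_smul_eq_nsmul]
    have ht : ∀ S T : L2 Γ →L[ℂ] L2 Γ, (trace (S - T)).re = (trace S).re - (trace T).re := by
      intro S T
      simp [trace]
    have hs : ∀ S : L2 Γ →L[ℂ] L2 Γ, (trace ((q : ℂ) • S)).re = q * (trace S).re := by
      intro S
      simp [trace]
    simp only [map_sub, hq', ht, hs] at h
    have h1 : eta Y (n + 2) - q * eta Y (n + 1) = zeta Y (n + 2) - zeta Y (n + 1) := by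
      have := card_closedWords_succ_add hY (n := n + 1) (by omega)
      rw [eta_eq_card, eta_eq_card, zeta_eq_card Y (by omega), zeta_eq_card Y (by omega)]
      have h' : ((closedWords Y (n + 2)).card : ℝ) + (cyclicClosedWords Y (n + 1)).card =
        (cyclicClosedWords Y (n + 2)).card + q * (closedWords Y (n + 1)).card := by
        exact_mod_cast this
      linarith
    have h2 : eta Y (n + 2) = (trace (regularRep Γ (hSeq Y (2 * n + 4)))).re := rfl
    have h3 : eta Y (n + 1) = (trace (regularRep Γ (hSeq Y (2 * n + 2)))).re := rfl
    rw [← h2, ← h3, h1, ih] at h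
    linarith

theorem exists_le_zeta (hq : 1 ≤ q) (hY : Y.card = q + 1) {r : ℝ} (hr0 : 4 * q ≤ r)
    (hr : r < opNorm (sumElt Y) ^ 2) :
    ∃ c : ℝ, 0 < c ∧ ∀ n, n ≠ 0 → c * outer q r ^ (2 * n) - 2 * (q : ℝ) ^ n ≤ zeta Y n := by
  obtain ⟨c, hc, h⟩ := exists_le_inner_cheb (q := q) (regularRep_square_nonneg Y)
    (norm_deltaOne (Γ := Γ)) (fun T h1 h2 h3 => deltaOne_separating (square Y) T h1 h2 h3) hr0
    (by rwa [norm_regularRep_square])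
  refine ⟨c, hc, fun n hn => ?_⟩
  obtain ⟨m, rfl⟩ := Nat.exists_eq_succ_of_ne_zero hn
  have hq1 : (1 : ℝ) ≤ q := by exact_mod_cast hq
  rw [Nat.succ_eq_add_one, zeta_eq_trace hq hY, regularRep_cheb, trace]
  linarith [h (m + 1)]

end Estimates

/-! ### Limits of roots -/

section Limits

theorem tendsto_rpow_root {s : ℕ → ℝ} {C γ : ℝ} (hC : 0 < C) (hγ : 0 < γ)
    (hup : ∀ᶠ n : ℕ in atTop, s n ≤ C * ((n : ℝ) + 1) ^ 4 * γ ^ (2 * n))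
    (hlow : ∀ u, 0 < u → u < γ → ∃ c, 0 < c ∧ ∀ᶠ n : ℕ in atTop, c * u ^ (2 * n) ≤ s n) :
    Tendsto (fun n : ℕ => s n ^ (1 / (2 * (n : ℝ)))) atTop (𝓝 γ) := by
  have hexp : Tendsto (fun n : ℕ => 1 / (2 * (n : ℝ))) atTop (𝓝 0) := by
    refine tendsto_const_nhds.div_atTop ?_
    exact (tendsto_natCast_atTop_atTop).const_mul_atTop two_pos
  have hconst : ∀ c : ℝ, 0 < c →
      Tendsto (fun n : ℕ => c ^ (1 / (2 * (n : ℝ)))) atTop (𝓝 1) := by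
    intro c hc
    have := (tendsto_const_nhds (x := c)).rpow hexp (Or.inl hc.ne')
    simpa using this
  have hroot : ∀ (u : ℝ) (n : ℕ), 0 < u → n ≠ 0 → (u ^ (2 * n)) ^ (1 / (2 * (n : ℝ))) = u := by
    intro u n hu hn
    rw [← Real.rpow_natCast, ← Real.rpow_mul hu.le]
    have : (n : ℝ) ≠ 0 := by exact_mod_cast hn
    push_cast
    rw [mul_one_div_cancel (by positivity), Real.rpow_one]
  have hpoly : Tendsto (fun n : ℕ => (((n : ℝ) + 1) ^ 4) ^ (1 / (2 * (n : ℝ)))) atTop (𝓝 1) := by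
    -- With `x = n + 1` the exponent `4 / (2x - 2)` is `4 / (2n)`.
    have h1 := tendsto_rpow_div_mul_add 4 2 (-2) (by norm_num)
    have h2 : Tendsto (fun n : ℕ => (n : ℝ) + 1) atTop atTop :=
      tendsto_atTop_add_const_right _ _ tendsto_natCast_atTop_atTop
    refine (h1.comp h2).congr fun n => ?_
    have h3 : (0 : ℝ) ≤ (n : ℝ) + 1 := by positivity
    simp only [Function.comp]
    rw [← Real.rpow_natCast, ← Real.rpow_mul h3]
    congr 1
    push_cast
    rw [show 2 * ((n : ℝ) + 1) + -2 = 2 * n by ring]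
    ring
  have hpos : ∀ᶠ n : ℕ in atTop, 0 < s n := by
    obtain ⟨c, hc, h⟩ := hlow (γ / 2) (by positivity) (by linarith)
    filter_upwards [h] with n hn
    exact lt_of_lt_of_le (by positivity) hn
  refine tendsto_order.2 ⟨fun u hu => ?_, fun u hu => ?_⟩
  · obtain ⟨w, hw1, hw2⟩ := exists_between (max_lt hu hγ)
    have hw0 : 0 < w := (le_max_right _ _).trans_lt hw1
    obtain ⟨c, hc, h⟩ := hlow w hw0 hw2
    have ht : Tendsto (fun n : ℕ => c ^ (1 / (2 * (n : ℝ))) * w) atTop (𝓝 w) := by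
      simpa using (hconst c hc).mul_const w
    filter_upwards [h, ht.eventually (lt_mem_nhds ((le_max_left _ _).trans_lt hw1)),
      eventually_ne_atTop 0] with n h1 h2 h3
    refine h2.trans_le ?_
    calc c ^ (1 / (2 * (n : ℝ))) * w = (c * w ^ (2 * n)) ^ (1 / (2 * (n : ℝ))) := by
          rw [Real.mul_rpow hc.le (by positivity), hroot w n hw0 h3]
      _ ≤ _ := Real.rpow_le_rpow (by positivity) h1 (by positivity)
  · have ht : Tendsto (fun n : ℕ => C ^ (1 / (2 * (n : ℝ))) *
        (((n : ℝ) + 1) ^ 4) ^ (1 / (2 * (n : ℝ))) * γ) atTop (𝓝 γ) := by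
      simpa using ((hconst C hC).mul hpoly).mul_const γ
    filter_upwards [hup, hpos, ht.eventually (gt_mem_nhds hu), eventually_ne_atTop 0]
      with n h1 h2 h3 h4
    refine lt_of_le_of_lt ?_ h3
    calc s n ^ (1 / (2 * (n : ℝ))) ≤ (C * ((n : ℝ) + 1) ^ 4 * γ ^ (2 * n)) ^ (1 / (2 * (n : ℝ))) :=
          Real.rpow_le_rpow h2.le h1 (by positivity)
      _ = _ := by
          rw [Real.mul_rpow (by positivity) (by positivity), Real.mul_rpow hC.le (by positivity),
            hroot γ n hγ h4]

variable {Γ : Type*} [Group Γ] {Y : Finset Γ} {q : ℕ}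

theorem exists_le_zeta_of_lt (hq : 1 ≤ q) (hY : Y.card = q + 1)
    (hN : 4 * q < opNorm (sumElt Y) ^ 2) {u : ℝ} (hu0 : 0 < u)
    (hu : u < outer q (opNorm (sumElt Y) ^ 2)) :
    ∃ c : ℝ, 0 < c ∧ ∀ᶠ n : ℕ in atTop, c * u ^ (2 * n) ≤ zeta Y n := by
  set M := opNorm (sumElt Y) ^ 2
  have hq1 : (1 : ℝ) ≤ q := by exact_mod_cast hq
  have hs : √q < outer q M := by
    rw [← outer_four_mul]
    have h1 : √(4 * q : ℝ) < √M := Real.sqrt_lt_sqrt (by positivity) hN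
    have h2 := Real.sqrt_nonneg (M - 4 * q)
    unfold outer
    rw [sub_self, Real.sqrt_zero]
    linarith
  -- By continuity `r` can be taken below `‖h‖²` with `outer q r` still above `u` and `√q`. The
  -- error `2qⁿ` is then eventually at most half of the main term.
  obtain ⟨r, hr, hrM⟩ : ∃ r, max u √q < outer q r ∧ r < M := by
    have h1 := (continuous_outer q).continuousAt.eventually (lt_mem_nhds (max_lt hu hs))
    have h2 : ∀ᶠ r in 𝓝[<] M, max u √q < outer q r := h1.filter_mono nhdsWithin_le_nhds
    obtain ⟨r, hr⟩ := (h2.and self_mem_nhdsWithin).exists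
    exact ⟨r, hr.1, hr.2⟩
  have hur : u < outer q r := (le_max_left _ _).trans_lt hr
  have hsr : √q < outer q r := (le_max_right _ _).trans_lt hr
  have hr0 : 4 * q ≤ r := by
    by_contra h
    have := outer_mono q (not_le.1 h).le
    rw [outer_four_mul] at this
    linarith
  obtain ⟨c, hc, h⟩ := exists_le_zeta hq hY hr0 hrM
  refine ⟨c / 2, by positivity, ?_⟩
  have hpos : 0 < outer q r := hu0.trans hur
  have hlt : (q : ℝ) < outer q r ^ 2 := by
    calc (q : ℝ) = √q ^ 2 := (Real.sq_sqrt (by positivity)).symm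
      _ < _ := by gcongr
  have ht : Tendsto (fun n : ℕ => ((q : ℝ) / outer q r ^ 2) ^ n) atTop (𝓝 0) :=
    tendsto_pow_atTop_nhds_zero_of_lt_one (by positivity) ((div_lt_one (by positivity)).2 hlt)
  filter_upwards [ht.eventually (gt_mem_nhds (show 0 < c / 4 by positivity)),
    eventually_ne_atTop 0] with n h1 h2
  have h3 := h n h2
  rw [div_pow, div_lt_iff₀ (by positivity), ← pow_mul] at h1
  have h4 : u ^ (2 * n) ≤ outer q r ^ (2 * n) := by gcongr
  have h5 : c / 2 * u ^ (2 * n) ≤ c / 2 * outer q r ^ (2 * n) := by gcongr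
  linarith

theorem tendsto_roots (hq : 1 ≤ q) (hY : Y.card = q + 1)
    (hN : 4 * q < opNorm (sumElt Y) ^ 2) {γ : ℝ} (hγ : γ = outer q (opNorm (sumElt Y) ^ 2)) :
    Tendsto (fun n : ℕ => twoNorm (hSeq Y n) ^ (1 / (n : ℝ))) atTop (𝓝 γ) ∧
      Tendsto (fun n : ℕ => xi Y n ^ (1 / (2 * (n : ℝ)))) atTop (𝓝 γ) ∧
      Tendsto (fun n : ℕ => eta Y n ^ (1 / (2 * (n : ℝ)))) atTop (𝓝 γ) ∧
      Tendsto (fun n : ℕ => zeta Y n ^ (1 / (2 * (n : ℝ)))) atTop (𝓝 γ) := by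
  have hγ0 : 0 < γ := by
    rw [hγ]
    exact one_pos.trans_le (one_le_outer hq hN.le)
  have key : ∀ s : ℕ → ℝ, (∀ n, n ≠ 0 → zeta Y n ≤ s n) →
      (∀ n, n ≠ 0 → s n ≤ twoNorm (hSeq Y n) ^ 2) →
      Tendsto (fun n : ℕ => s n ^ (1 / (2 * (n : ℝ)))) atTop (𝓝 γ) := by
    intro s h1 h2
    refine tendsto_rpow_root (C := 16) (by norm_num) hγ0 ?_ ?_
    · filter_upwards [eventually_ne_atTop 0] with n hn
      rw [hγ]
      exact (h2 n hn).trans (twoNorm_hSeq_sq_le hq hY hN.le n)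
    · intro u hu0 hu
      obtain ⟨c, hc, h⟩ := exists_le_zeta_of_lt hq hY hN hu0 (hγ ▸ hu)
      refine ⟨c, hc, ?_⟩
      filter_upwards [h, eventually_ne_atTop 0] with n h3 h4
      exact h3.trans (h1 n h4)
  have hze := fun n (hn : n ≠ 0) => zeta_le_eta Y hn
  have hex := fun n (hn : n ≠ 0) => eta_le_xi hY hn
  have hxt := fun n (_ : n ≠ 0) => xi_le_twoNorm_sq hY n
  refine ⟨?_, key _ (fun n hn => (hze n hn).trans (hex n hn)) hxt,
    key _ hze (fun n hn => (hex n hn).trans (hxt n hn)),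
    key _ (fun _ _ => le_rfl) (fun n hn => (hze n hn).trans ((hex n hn).trans (hxt n hn)))⟩
  -- The first limit is the case `s = ‖h_n‖₂²`. At `n = 0` both exponents are `0`, as `1 / 0 = 0`.
  refine (key _ (fun n hn => (hze n hn).trans ((hex n hn).trans (hxt n hn)))
    (fun _ _ => le_rfl)).congr fun n => ?_
  have h0 : 0 ≤ twoNorm (hSeq Y n) := Real.sqrt_nonneg _
  rw [← Real.rpow_natCast, ← Real.rpow_mul h0]
  congr 1
  rcases eq_or_ne n 0 with rfl | hn
  · simp
  · have : (n : ℝ) ≠ 0 := by exact_mod_cast hn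
    push_cast
    field_simp

end Limits

/-! ### Elements with nonnegative coefficients -/

section Positive

variable {Γ : Type*} [Group Γ]

open ComplexOrder in
/-- The coefficients of an element of the group ring are nonnegative. -/
def NonnegCoeff (b : MonoidAlgebra ℂ Γ) : Prop := ∀ g, 0 ≤ b.coeff g

open ComplexOrder

theorem NonnegCoeff.add {b c : MonoidAlgebra ℂ Γ} (hb : NonnegCoeff b) (hc : NonnegCoeff c) :
    NonnegCoeff (b + c) := fun g => add_nonneg (hb g) (hc g)

theorem NonnegCoeff.sum {ι : Type*} {S : Finset ι} {b : ι → MonoidAlgebra ℂ Γ}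
    (hb : ∀ i ∈ S, NonnegCoeff (b i)) : NonnegCoeff (∑ i ∈ S, b i) := fun g => by
  rw [MonoidAlgebra.coeff_sum, Finsupp.finsetSum_apply]
  exact Finset.sum_nonneg fun i hi => hb i hi g

theorem nonnegCoeff_of (g : Γ) : NonnegCoeff (MonoidAlgebra.of ℂ Γ g) := fun x => by
  classical
  rw [MonoidAlgebra.of_apply, MonoidAlgebra.coeff_single, Finsupp.single_apply]
  split_ifs <;> simp

theorem nonnegCoeff_one : NonnegCoeff (1 : MonoidAlgebra ℂ Γ) := by
  rw [← map_one (MonoidAlgebra.of ℂ Γ)]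
  exact nonnegCoeff_of 1

theorem NonnegCoeff.mul {b c : MonoidAlgebra ℂ Γ} (hb : NonnegCoeff b) (hc : NonnegCoeff c) :
    NonnegCoeff (b * c) := fun g => by
  rw [MonoidAlgebra.coeff_mul_apply_left]
  exact Finset.sum_nonneg fun x _ => mul_nonneg (hb _) (hc _)

theorem NonnegCoeff.pow {b : MonoidAlgebra ℂ Γ} (hb : NonnegCoeff b) (n : ℕ) :
    NonnegCoeff (b ^ n) := by
  induction n with
  | zero => rw [pow_zero]; exact nonnegCoeff_one
  | succ n ih => rw [pow_succ]; exact ih.mul hb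

theorem nonnegCoeff_sumElt (Y : Finset Γ) : NonnegCoeff (sumElt Y) :=
  NonnegCoeff.sum fun g _ => nonnegCoeff_of g

theorem nonnegCoeff_square (Y : Finset Γ) : NonnegCoeff (square Y) :=
  (nonnegCoeff_sumElt _).mul (nonnegCoeff_sumElt _)

theorem nonnegCoeff_sumElt_sub {Y : Finset Γ} {g : Γ} (hg : g ∈ Y) :
    NonnegCoeff (sumElt Y - MonoidAlgebra.of ℂ Γ g) := by
  classical
  rw [sumElt, ← Finset.sum_erase_add _ _ hg, add_sub_cancel_right]
  exact NonnegCoeff.sum fun g _ => nonnegCoeff_of g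

/-- Expanding `(h*h)ᵐ` yields every alternating product of `2m` letters of `Y`, reduced or not;
removing one of these terms leaves a sum of group elements. -/
theorem nonnegCoeff_square_pow_sub {Y : Finset Γ} (m : ℕ) {l : List Γ} (hlen : l.length = 2 * m)
    (hl : ∀ x ∈ l, x ∈ Y) :
    NonnegCoeff (square Y ^ m - MonoidAlgebra.of ℂ Γ (listProd l)) := by
  induction m generalizing l with
  | zero =>
    rw [mul_zero, List.length_eq_zero_iff] at hlen
    subst hlen
    rw [pow_zero, listProd, map_one, sub_self]
    exact fun g => le_rfl
  | succ m ih =>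
    rcases l with _ | ⟨a, _ | ⟨b, l⟩⟩
    · simp at hlen
    · simp at hlen; omega
    have hlen' : l.length = 2 * m := by simp at hlen; omega
    have h := ih hlen' fun x hx => hl x (by simp [hx])
    have ha := nonnegCoeff_sumElt_sub (mem_invSet.2 (by simpa using hl a (by simp)) :
      a⁻¹ ∈ invSet Y)
    have hb := nonnegCoeff_sumElt_sub (hl b (by simp))
    rw [listProd_cons_of_odd (by simp [hlen']),
      listProd_cons_of_even (by simp [hlen']), map_mul, map_mul]
    have e : square Y ^ (m + 1) - MonoidAlgebra.of ℂ Γ a⁻¹ *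
        (MonoidAlgebra.of ℂ Γ b * MonoidAlgebra.of ℂ Γ (listProd l)) =
        square Y * (square Y ^ m - MonoidAlgebra.of ℂ Γ (listProd l)) +
        (sumElt (invSet Y) * (sumElt Y - MonoidAlgebra.of ℂ Γ b) +
          (sumElt (invSet Y) - MonoidAlgebra.of ℂ Γ a⁻¹) * MonoidAlgebra.of ℂ Γ b) *
          MonoidAlgebra.of ℂ Γ (listProd l) := by
      rw [pow_succ', square]
      noncomm_ring
    rw [e]
    exact ((nonnegCoeff_square Y).mul h).add
      ((((nonnegCoeff_sumElt _).mul hb).add (ha.mul (nonnegCoeff_of b))).mul (nonnegCoeff_of _))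

theorem coeff_one_le_mapDomain {G : Type*} [Group G] (π : G →* Γ) {b : MonoidAlgebra ℂ G}
    (hb : NonnegCoeff b) :
    b.coeff 1 ≤ (MonoidAlgebra.mapDomainRingHom ℂ π b).coeff 1 := by
  classical
  have h : (MonoidAlgebra.mapDomainRingHom ℂ π b).coeff 1 =
      ∑ g ∈ b.coeff.support, if π g = 1 then b.coeff g else 0 := by
    change (Finsupp.mapDomain π b.coeff) 1 = _
    rw [Finsupp.mapDomain, Finsupp.sum, Finsupp.finsetSum_apply]
    simp only [Finsupp.single_apply]
  rw [h]
  by_cases h1 : b.coeff 1 = 0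
  · rw [h1]
    refine Finset.sum_nonneg fun g _ => ?_
    split_ifs
    · exact hb g
    · exact le_rfl
  · have := Finset.single_le_sum (f := fun g => if π g = 1 then b.coeff g else 0)
      (s := b.coeff.support) (fun g _ => by
        split_ifs
        · exact hb g
        · exact le_rfl) (Finsupp.mem_support_iff.2 h1)
    simpa using this

/-- Group homomorphisms do not decrease the norm of elements with nonnegative coefficients. -/
theorem opNorm_le_opNorm_mapDomain {G : Type*} [Group G] (π : G →* Γ) {b : MonoidAlgebra ℂ G}
    (hb : NonnegCoeff b) (hpos : 0 ≤ regularRep G b) :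
    opNorm b ≤ opNorm (MonoidAlgebra.mapDomainRingHom ℂ π b) := by
  by_contra! hlt
  set ρ := opNorm (MonoidAlgebra.mapDomainRingHom ℂ π b)
  have hρ0 : 0 ≤ ρ := opNorm_nonneg _
  obtain ⟨r, hr1, hr2⟩ := exists_between hlt
  have hr0 : 0 < r := hρ0.trans_lt hr1
  obtain ⟨c, hc, h⟩ := exists_le_inner_pow hpos (δ := deltaOne G)
    (norm_ne_zero_iff.1 (by rw [norm_deltaOne]; exact one_ne_zero))
    (fun T h1 h2 h3 => deltaOne_separating b T h1 h2 h3) hr0.le hr2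
  -- Moments are compared: `c rⁿ ≤ τ(bⁿ) ≤ τ(π(b)ⁿ) ≤ ρⁿ`, the middle inequality because the
  -- coefficients of `bⁿ` over the kernel of `π` are nonnegative. This is absurd for `ρ < r`.
  have key : ∀ n : ℕ, c ≤ (ρ / r) ^ n := by
    intro n
    rw [div_pow, le_div_iff₀ (by positivity)]
    refine (h n).trans ?_
    have e1 : inner ℂ (deltaOne G) ((regularRep G b ^ n) (deltaOne G)) = (b ^ n).coeff 1 := by
      rw [← map_pow, ← trace_regularRep, trace]
    rw [e1]
    refine (Complex.le_def.1 (coeff_one_le_mapDomain π (hb.pow n))).1.trans ?_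
    rw [map_pow, ← trace_regularRep, map_pow, trace]
    refine (Complex.re_le_norm _).trans ((norm_inner_le_norm _ _).trans ?_)
    rw [norm_deltaOne, one_mul]
    refine (ContinuousLinearMap.le_opNorm _ _).trans ?_
    rw [norm_deltaOne, mul_one]
    clear e1
    induction n with
    | zero =>
      rw [pow_zero, pow_zero]
      exact ContinuousLinearMap.norm_id_le
    | succ n ih =>
      rw [pow_succ, pow_succ]
      exact (norm_mul_le _ _).trans (mul_le_mul_of_nonneg_right ih (norm_nonneg _))
  have ht := tendsto_pow_atTop_nhds_zero_of_lt_one (div_nonneg hρ0 hr0.le)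
    ((div_lt_one hr0).2 hr1)
  obtain ⟨n, hn⟩ := (ht.eventually (gt_mem_nhds hc)).exists
  exact absurd (key n) (not_le.2 hn)

end Positive

/-! ### The free group -/

section Free

variable {α : Type*}

/-- The word in the free group with letters `l` and alternating signs. -/
def signedWord : List α → List (α × Bool)
  | [] => []
  | a :: l => (a, decide (Even l.length)) :: signedWord l

theorem map_fst_signedWord (l : List α) : (signedWord l).map Prod.fst = l := by
  induction l with
  | nil => rfl
  | cons a l ih => simp [signedWord, ih]

theorem mk_signedWord (l : List α) :
    FreeGroup.mk (signedWord l) = listProd (l.map FreeGroup.of) := by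
  induction l with
  | nil => rfl
  | cons a l ih =>
    rw [List.map_cons, listProd, ← ih, signedWord, List.length_map]
    by_cases h : Even l.length
    · rw [if_pos h, decide_eq_true h]
      rfl
    · rw [if_neg h, decide_eq_false h]
      rfl

/-- Adjacent letters are distinct generators, so no cancellation can occur whatever the signs are.
-/
theorem isReduced_signedWord {l : List α} (h : l.IsChain (· ≠ ·)) :
    FreeGroup.IsReduced (signedWord l) := by
  induction l with
  | nil => simp [signedWord, FreeGroup.IsReduced]
  | cons a l ih =>
    rcases l with _ | ⟨b, l⟩
    · simp [signedWord, FreeGroup.IsReduced]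
    · rw [List.isChain_cons_cons] at h
      have := ih h.2
      simp only [signedWord, FreeGroup.IsReduced, List.isChain_cons_cons] at this ⊢
      exact ⟨fun hab => absurd hab h.1, this⟩

theorem listProd_map_of_injective {l l' : List α} (hl : l.IsChain (· ≠ ·))
    (hl' : l'.IsChain (· ≠ ·))
    (h : listProd (l.map FreeGroup.of) = listProd (l'.map FreeGroup.of)) : l = l' := by
  classical
  rw [← mk_signedWord, ← mk_signedWord] at h
  have h2 := FreeGroup.reduce.sound h
  rw [(isReduced_signedWord hl).reduce_eq, (isReduced_signedWord hl').reduce_eq] at h2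
  rw [← map_fst_signedWord l, h2, map_fst_signedWord]

/-- The set of free generators of the free group given by a finite set. -/
def freeSet (Y : Finset α) : Finset (FreeGroup α) :=
  Y.map ⟨FreeGroup.of, FreeGroup.of_injective⟩

theorem map_of_mem_listWords [Group α] {Y : Finset α} {n : ℕ} {l : List α}
    (hl : l ∈ listWords Y n) : l.map FreeGroup.of ∈ listWords (freeSet Y) n := by
  obtain ⟨hlen, hY, hc⟩ := mem_listWords.1 hl
  refine mem_listWords.2 ⟨by simpa using hlen, ?_, ?_⟩
  · simp only [List.forall_mem_map, freeSet, Finset.mem_map, Function.Embedding.coeFn_mk]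
    exact fun x hx => ⟨x, hY x hx, rfl⟩
  · rw [List.isChain_map]
    simpa [FreeGroup.of_injective.eq_iff] using hc

/-- The words of a free set have distinct products. -/
def IsFree {G : Type*} [Group G] (X : Finset G) : Prop :=
  ∀ n n' : ℕ, ∀ l ∈ listWords X n, ∀ l' ∈ listWords X n', listProd l = listProd l' → l = l'

theorem isFree_freeSet (Y : Finset α) : IsFree (freeSet Y) := by
  have key : ∀ n, ∀ l ∈ listWords (freeSet Y) n,
      ∃ r : List α, r.IsChain (· ≠ ·) ∧ l = r.map FreeGroup.of := by
    intro n l hl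
    obtain ⟨-, hY, hc⟩ := mem_listWords.1 hl
    have : l ∈ Set.range (List.map (FreeGroup.of (α := α))) := by
      rw [Set.range_list_map]
      intro x hx
      obtain ⟨y, -, rfl⟩ := Finset.mem_map.1 (hY x hx)
      exact ⟨y, rfl⟩
    obtain ⟨r, rfl⟩ := this
    refine ⟨r, ?_, rfl⟩
    rw [List.isChain_map] at hc
    simpa [FreeGroup.of_injective.eq_iff] using hc
  intro n n' l hl l' hl' h
  obtain ⟨r, hr, rfl⟩ := key n l hl
  obtain ⟨r', hr', rfl⟩ := key n' l' hl'
  rw [listProd_map_of_injective hr hr' h]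

end Free

/-! ### Test vectors for free sets -/

section TestVector

variable {G : Type*} [Group G] {X : Finset G} {q : ℕ}

/-- A truncated spherical function at the top of the spectrum of the tree. -/
def testElt (X : Finset G) (q K : ℕ) : MonoidAlgebra ℂ G :=
  ∑ k ∈ Finset.range (K + 1), ((q : ℂ) ^ k)⁻¹ • hSeq X (2 * k)

theorem square_mul_hSeq (hX : X.card = q + 1) {n : ℕ} (hn : n ≠ 0) :
    square X * hSeq X (2 * n + 2) =
      hSeq X (2 * n + 4) + (2 * q : ℂ) • hSeq X (2 * n + 2) + (q ^ 2 : ℂ) • hSeq X (2 * n) := by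
  have h1 : (2 * q : ℂ) • hSeq X (2 * n + 2) = 2 * q * hSeq X (2 * n + 2) := by
    rw [Algebra.smul_def, map_mul, map_natCast, map_ofNat]
  have h2 : (q ^ 2 : ℂ) • hSeq X (2 * n) = q ^ 2 * hSeq X (2 * n) := by
    rw [Algebra.smul_def, map_pow, map_natCast]
  rw [hSeq_add_four hX hn, h1, h2]
  noncomm_ring

/-- At interior levels the weights `q⁻ᵏ` give `q·q⁻ᵏ + 2q·q⁻ᵏ + q·q⁻ᵏ = 4q·q⁻ᵏ`, which cancels; only
the root and the truncation boundary survive. -/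
theorem square_sub_mul_testElt (hq : 1 ≤ q) (hX : X.card = q + 1) {K : ℕ} (hK : 1 ≤ K) :
    (square X - algebraMap ℂ _ (4 * q)) * testElt X q K =
      (2 - 2 * q : ℂ) • hSeq X 0 - (q * ((q : ℂ) ^ K)⁻¹) • hSeq X (2 * K) +
        ((q : ℂ) ^ K)⁻¹ • hSeq X (2 * K + 2) := by
  have hq0 : (q : ℂ) ≠ 0 := by
    have : q ≠ 0 := by omega
    exact_mod_cast this
  have hsub : ∀ b : MonoidAlgebra ℂ G,
      (square X - algebraMap ℂ _ (4 * q)) * b = square X * b - (4 * q : ℂ) • b := fun b => by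
    rw [sub_mul, Algebra.smul_def]
  induction K, hK using Nat.le_induction with
  | base =>
    have e0 : square X * hSeq X 0 = hSeq X 2 + (q + 1 : ℂ) • hSeq X 0 := by
      rw [hSeq_zero, mul_one, hSeq_two hX, Algebra.smul_def, map_add, map_natCast, map_one]
      noncomm_ring
    have e2 : square X * hSeq X 2 =
        hSeq X 4 + (2 * q : ℂ) • hSeq X 2 + (q * (q + 1) : ℂ) • hSeq X 0 := by
      have h1 : (2 * q : ℂ) • hSeq X 2 = 2 * q * hSeq X 2 := by
        rw [Algebra.smul_def, map_mul, map_natCast, map_ofNat]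
      have h2 : (q * (q + 1) : ℂ) • hSeq X 0 = q * (q + 1) := by
        rw [hSeq_zero, Algebra.smul_def, map_mul, map_add, map_natCast, map_one, mul_one]
      rw [hSeq_four hX, h1, h2]
      noncomm_ring
    rw [hsub, testElt, Finset.sum_range_succ, Finset.sum_range_one]
    simp only [mul_add, mul_smul_comm, pow_zero, pow_one, mul_zero, mul_one, inv_one, one_smul,
      e0, e2, Nat.reduceAdd]
    match_scalars <;> field_simp <;> ring
  | succ K hK ih =>
    have e : testElt X q (K + 1) = testElt X q K + ((q : ℂ) ^ (K + 1))⁻¹ • hSeq X (2 * K + 2) := by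
      rw [testElt, Finset.sum_range_succ]
      rfl
    have hs := square_mul_hSeq hX (n := K) (by omega)
    rw [e, mul_add, ih, hsub, mul_smul_comm, hs]
    have hc : ((q : ℂ) ^ K)⁻¹ = q * ((q : ℂ) ^ (K + 1))⁻¹ := by
      rw [pow_succ]
      field_simp
    rw [hc]
    change _ = _ - _ • hSeq X (2 * K + 2) + _ • hSeq X (2 * K + 4)
    module

theorem coeff_hSeq_of_isFree (hfree : IsFree X) {n : ℕ} {l : List G} (hl : l ∈ listWords X n)
    (m : ℕ) : (hSeq X m).coeff (listProd l) = if m = n then 1 else 0 := by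
  classical
  rw [hSeq_eq, MonoidAlgebra.coeff_sum, Finsupp.finsetSum_apply]
  simp only [MonoidAlgebra.of_apply, MonoidAlgebra.coeff_single, Finsupp.single_apply]
  split_ifs with hmn
  · subst hmn
    rw [Finset.sum_eq_single_of_mem l hl, if_pos rfl]
    intro l' hl' hne
    rw [if_neg]
    exact fun h => hne (hfree _ _ _ hl' _ hl h)
  · refine Finset.sum_eq_zero fun l' hl' => ?_
    rw [if_neg]
    intro h
    have := hfree _ _ _ hl' _ hl h
    subst this
    exact hmn ((mem_listWords.1 hl').1.symm.trans (mem_listWords.1 hl).1)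

theorem coeff_testElt (hfree : IsFree X) {n : ℕ} {l : List G} (hl : l ∈ listWords X (2 * n))
    (K : ℕ) :
    (testElt X q K).coeff (listProd l) = if n ≤ K then ((q : ℂ) ^ n)⁻¹ else 0 := by
  rw [testElt, MonoidAlgebra.coeff_sum, Finsupp.finsetSum_apply]
  simp only [MonoidAlgebra.coeff_smul_apply, coeff_hSeq_of_isFree hfree hl]
  simp

/-- The test vector. -/
def testVector (X : Finset G) (q K : ℕ) : L2 G := regularRep G (testElt X q K) (deltaOne G)

/-- Each level `k ≥ 1` carries `(q + 1) q²ᵏ⁻¹` distinct group elements of weight `q⁻ᵏ`, so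
contributes `(q + 1)/q`. The linear growth in `K` is what the estimates below exploit. -/
theorem norm_testVector_sq (hq : 1 ≤ q) (hX : X.card = q + 1) (hfree : IsFree X) (K : ℕ) :
    ‖testVector X q K‖ ^ 2 = 1 + K * ((q + 1) / q : ℝ) := by
  have hq0 : (q : ℝ) ≠ 0 := by
    have : q ≠ 0 := by omega
    exact_mod_cast this
  have e : testVector X q K = ∑ p ∈ (Finset.range (K + 1)).sigma fun k => listWords X (2 * k),
      ((((q : ℝ) ^ p.1)⁻¹ : ℝ) : ℂ) • delta (listProd p.2) := by
    rw [testVector, testElt, map_sum, sum_apply, Finset.sum_sigma]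
    refine Finset.sum_congr rfl fun k _ => ?_
    rw [map_smul, smul_apply, regularRep_hSeq_deltaOne, Finset.smul_sum]
    push_cast
    rfl
  rw [e, norm_sum_delta_sq_of_injOn, Finset.sum_sigma, Finset.sum_range_succ']
  · simp only [Finset.sum_const, listWords_zero, mul_zero, Finset.card_singleton]
    have : ∀ k : ℕ, (listWords X (2 * (k + 1))).card • (((q : ℝ) ^ (k + 1))⁻¹) ^ 2 =
        (q + 1) / q := by
      intro k
      rw [show 2 * (k + 1) = (2 * k + 1) + 1 by ring, card_listWords_succ hX, nsmul_eq_mul]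
      push_cast
      field_simp
      ring
    simp only [this, Finset.sum_const, Finset.card_range, nsmul_eq_mul]
    norm_num
    ring
  · rintro ⟨k, l⟩ h ⟨k', l'⟩ h' hll
    simp only [Finset.coe_sigma, Set.mem_sigma_iff, Finset.mem_coe] at h h'
    have := hfree _ _ _ h.2 _ h'.2 hll
    subst this
    have h1 := (mem_listWords.1 h.2).1
    have h2 := (mem_listWords.1 h'.2).1
    obtain rfl : k = k' := by omega
    rfl

theorem norm_hSeq_deltaOne_le (hq : 1 ≤ q) (hX : X.card = q + 1) (hfree : IsFree X) (k : ℕ) :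
    ‖regularRep G (hSeq X (2 * k)) (deltaOne G)‖ ≤ (q + 1) * (q : ℝ) ^ k := by
  have hq1 : (1 : ℝ) ≤ q := by exact_mod_cast hq
  have h : ‖regularRep G (hSeq X (2 * k)) (deltaOne G)‖ ^ 2 = (listWords X (2 * k)).card := by
    have := norm_sum_delta_sq_of_injOn (listWords X (2 * k)) (fun _ => 1) listProd
      (fun l hl l' hl' h => hfree _ _ _ hl _ hl' h)
    rw [regularRep_hSeq_deltaOne]
    simpa using this
  refine abs_le_of_sq_le_sq' ?_ (by positivity) |>.2
  rw [h]
  rcases k with _ | k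
  · rw [mul_zero, listWords_zero]
    simp only [Finset.card_singleton, Nat.cast_one, pow_zero, mul_one]
    nlinarith
  · rw [show 2 * (k + 1) = (2 * k + 1) + 1 by ring, card_listWords_succ hX]
    push_cast
    have e : ((q + 1) * (q : ℝ) ^ (k + 1)) ^ 2 = (q + 1) * q ^ (2 * k + 1) * ((q + 1) * q) := by
      ring
    rw [e]
    refine le_mul_of_one_le_right (by positivity) ?_
    nlinarith

/-- The test vectors are approximate eigenvectors: the defect is bounded. -/
theorem norm_square_sub_testVector_le (hq : 1 ≤ q) (hX : X.card = q + 1) (hfree : IsFree X)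
    {K : ℕ} (hK : 1 ≤ K) :
    ‖(regularRep G (square X) - algebraMap ℂ _ (4 * q)) (testVector X q K)‖ ≤
      2 * (q + 1) ^ 2 + 2 * q := by
  have hq1 : (1 : ℝ) ≤ q := by exact_mod_cast hq
  have e : regularRep G _ (deltaOne G) = regularRep G _ (deltaOne G) :=
    congrArg (fun b => regularRep G b (deltaOne G)) (square_sub_mul_testElt hq hX hK)
  rw [map_mul, map_sub, AlgHom.commutes, map_add, map_sub, map_smul, map_smul, map_smul,
    mul_apply_eq_comp] at e
  rw [testVector, e, add_apply, sub_apply, smul_apply, smul_apply, smul_apply]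
  have n1 := norm_hSeq_deltaOne_le hq hX hfree K
  have n2 : ‖regularRep G (hSeq X (2 * K + 2)) (deltaOne G)‖ ≤ (q + 1) * (q : ℝ) ^ (K + 1) :=
    norm_hSeq_deltaOne_le hq hX hfree (K + 1)
  refine (norm_add_le _ _).trans ((add_le_add (norm_sub_le _ _) le_rfl).trans ?_)
  rw [norm_smul, norm_smul, norm_smul, hSeq_zero, map_one, one_apply_eq_self,
    norm_deltaOne, mul_one, norm_mul, norm_inv, norm_pow, Complex.norm_natCast]
  have h1 : ‖(2 - 2 * q : ℂ)‖ ≤ 2 * q := by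
    have : (2 - 2 * q : ℂ) = ((2 - 2 * q : ℝ) : ℂ) := by push_cast; rfl
    rw [this, Complex.norm_real, Real.norm_eq_abs, abs_le]
    constructor <;> linarith
  have h2 : (q : ℝ) * ((q : ℝ) ^ K)⁻¹ * ‖regularRep G (hSeq X (2 * K)) (deltaOne G)‖ ≤
      (q + 1) * q := by
    calc _ ≤ (q : ℝ) * ((q : ℝ) ^ K)⁻¹ * ((q + 1) * (q : ℝ) ^ K) := by gcongr
      _ = _ := by field_simp
  have h3 : ((q : ℝ) ^ K)⁻¹ * ‖regularRep G (hSeq X (2 * K + 2)) (deltaOne G)‖ ≤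
      (q + 1) * q := by
    calc _ ≤ ((q : ℝ) ^ K)⁻¹ * ((q + 1) * (q : ℝ) ^ (K + 1)) := by gcongr
      _ = _ := by rw [pow_succ]; field_simp
  nlinarith

/-- With a spectral gap `ε` below `4q` the bounded defect would give `ε ‖f_K‖ ≤ D` for all `K ≥ 1`,
whereas `‖f_K‖² ≥ K`. -/
theorem four_mul_le_opNorm_square (hq : 1 ≤ q) (hX : X.card = q + 1) (hfree : IsFree X) :
    4 * q ≤ opNorm (square X) := by
  have hq1 : (1 : ℝ) ≤ q := by exact_mod_cast hq
  by_contra! hlt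
  set D : ℝ := 2 * (q + 1) ^ 2 + 2 * q
  have hD : 0 < D := by positivity
  set ε := 4 * q - opNorm (square X)
  have hε : 0 < ε := by simp only [ε]; linarith
  obtain ⟨K, hK⟩ := exists_nat_gt ((D / ε) ^ 2)
  have hK1 : 1 ≤ K := by
    by_contra h
    have : K = 0 := by omega
    subst this
    have : 0 ≤ (D / ε) ^ 2 := by positivity
    simp at hK
    linarith
  have h1 := norm_square_sub_testVector_le hq hX hfree hK1
  have h2 := norm_testVector_sq hq hX hfree K
  set f := testVector X q K
  have h3 : ε * ‖f‖ ≤ D := by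
    have e : (algebraMap ℂ (L2 G →L[ℂ] L2 G) (4 * q)) f = (4 * q : ℂ) • f := by
      rw [Algebra.algebraMap_eq_smul_one]
      rfl
    rw [sub_apply, e] at h1
    have h4 := norm_sub_norm_le ((4 * q : ℂ) • f) (regularRep G (square X) f)
    rw [norm_sub_rev, norm_smul] at h4
    have h5 := (regularRep G (square X)).le_opNorm f
    have h6 : ‖(4 * q : ℂ)‖ = 4 * q := by simp
    rw [h6] at h4
    simp only [ε, opNorm, sub_mul]
    linarith
  have h4 : (K : ℝ) ≤ ‖f‖ ^ 2 := by
    rw [h2]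
    have : 1 ≤ ((q : ℝ) + 1) / q := by
      rw [le_div_iff₀ (by linarith)]
      linarith
    nlinarith [Nat.cast_nonneg (α := ℝ) K]
  have h5 : ‖f‖ ≤ D / ε := by
    rw [le_div_iff₀ hε]
    linarith
  have h6 : ‖f‖ ^ 2 ≤ (D / ε) ^ 2 := by gcongr
  linarith

/-- The test vectors are not approximately invariant under a nontrivial word. -/
theorem le_norm_testVector_sub_sq (hq : 2 ≤ q) (hX : X.card = q + 1) (hfree : IsFree X) {m : ℕ}
    (hm : 1 ≤ m) {w : List G} (hw : w ∈ listWords X (2 * m)) (K : ℕ) :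
    (K + 1 : ℝ) / 4 ≤
      ‖testVector X q K - leftRegularRep G (listProd w) (testVector X q K)‖ ^ 2 := by
  classical
  have hq2 : (2 : ℝ) ≤ q := by exact_mod_cast hq
  obtain ⟨hwlen, hwX, hwc⟩ := mem_listWords.1 hw
  rcases w with _ | ⟨a, w⟩
  · simp at hwlen
    omega
  have ha : a ∈ X := hwX a (by simp)
  set f := testVector X q K with hf
  set F := f - leftRegularRep G (listProd (a :: w)) f
  -- For words `l` not starting with the first letter of `w`, the product `w⁻¹ l` is again reduced,
  -- `m` levels further out. There the coefficient is at most `q⁻ᵏ/2`, since `q ≥ 2` and `m ≥ 1`.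
  set S := (Finset.range (K + 1)).sigma fun k =>
    (listWords X (2 * k)).filter fun l => l.head? ≠ some a
  have hval : ∀ p ∈ S, (((q : ℝ) ^ p.1)⁻¹ / 2) ^ 2 ≤ ‖(F : G → ℂ) (listProd p.2)‖ ^ 2 := by
    rintro ⟨k, l⟩ hp
    simp only [S, Finset.mem_sigma, Finset.mem_range, Finset.mem_filter] at hp
    obtain ⟨hk, hl, hla⟩ := hp
    obtain ⟨hllen, hlX, hlc⟩ := mem_listWords.1 hl
    have hwl : (a :: w).reverse ++ l ∈ listWords X (2 * (m + k)) := by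
      refine mem_listWords.2 ⟨?_, ?_, ?_⟩
      · rw [List.length_append, List.length_reverse, hwlen, hllen]
        ring
      · intro x hx
        rw [List.mem_append, List.mem_reverse] at hx
        exact hx.elim (hwX x) (hlX x)
      · rw [List.isChain_append]
        refine ⟨?_, hlc, ?_⟩
        · rw [List.isChain_reverse]
          simpa [ne_comm] using hwc
        · intro x hx y hy hxy
          rw [List.getLast?_reverse] at hx
          simp only [List.head?_cons, Option.mem_def, Option.some.injEq] at hx
          subst hx hxy
          exact hla hy
    have e1 : (f : G → ℂ) (listProd l) = ((q : ℂ) ^ k)⁻¹ := by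
      rw [hf, testVector, regularRep_deltaOne_apply, coeff_testElt hfree hl, if_pos (by omega)]
    have e2 : (leftRegularRep G (listProd (a :: w)) f : G → ℂ) (listProd l) =
        if m + k ≤ K then ((q : ℂ) ^ (m + k))⁻¹ else 0 := by
      rw [leftRegularRep_apply, inv_listProd_mul_listProd _ _ (by rw [hwlen, hllen]; grind),
        hf, testVector, regularRep_deltaOne_apply, coeff_testElt hfree hwl]
    have e3 : ‖(leftRegularRep G (listProd (a :: w)) f : G → ℂ) (listProd l)‖ ≤
        ((q : ℝ) ^ k)⁻¹ / 2 := by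
      rw [e2]
      split_ifs
      · rw [norm_inv, norm_pow, Complex.norm_natCast, pow_add, mul_inv, mul_comm, div_eq_mul_inv]
        gcongr
        calc (2 : ℝ) ≤ q := hq2
          _ = (q : ℝ) ^ 1 := (pow_one _).symm
          _ ≤ _ := pow_le_pow_right₀ (by linarith) hm
      · rw [norm_zero]
        positivity
    have e4 : ‖(f : G → ℂ) (listProd l)‖ = ((q : ℝ) ^ k)⁻¹ := by
      rw [e1, norm_inv, norm_pow, Complex.norm_natCast]
    have e5 : (F : G → ℂ) (listProd l) = (f : G → ℂ) (listProd l) -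
        (leftRegularRep G (listProd (a :: w)) f : G → ℂ) (listProd l) := rfl
    have e6 := norm_sub_norm_le ((f : G → ℂ) (listProd l))
      ((leftRegularRep G (listProd (a :: w)) f : G → ℂ) (listProd l))
    rw [← e5, e4] at e6
    have e7 : ((q : ℝ) ^ k)⁻¹ / 2 ≤ ‖(F : G → ℂ) (listProd l)‖ := by linarith
    dsimp only
    gcongr
  have hinj : Set.InjOn (fun p : (_ : ℕ) × List G => listProd p.2) S := by
    rintro ⟨k, l⟩ h ⟨k', l'⟩ h' hll
    simp only [S, Finset.mem_coe, Finset.mem_sigma, Finset.mem_filter] at h h'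
    have := hfree _ _ _ h.2.1 _ h'.2.1 hll
    subst this
    have h1 := (mem_listWords.1 h.2.1).1
    have h2 := (mem_listWords.1 h'.2.1).1
    obtain rfl : k = k' := by omega
    rfl
  have hsum := lp.sum_rpow_le_norm_rpow (p := 2) (by norm_num) F
    (S.image fun p => listProd p.2)
  rw [Finset.sum_image hinj] at hsum
  simp only [ENNReal.toReal_ofNat, Real.rpow_ofNat] at hsum
  refine le_trans ?_ ((Finset.sum_le_sum hval).trans hsum)
  rw [Finset.sum_sigma]
  -- Level `k` contains `q²ᵏ` such words, each contributing `(q⁻ᵏ/2)²`.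
  have : ∀ k : ℕ, (∑ _l ∈ (listWords X (2 * k)).filter fun l => l.head? ≠ some a,
      (((q : ℝ) ^ k)⁻¹ / 2) ^ 2) = 1 / 4 := by
    intro k
    rw [Finset.sum_const, card_filter_head_ne hX _ ha, nsmul_eq_mul]
    push_cast
    field_simp
    ring
  simp only [this]
  rw [Finset.sum_const, Finset.card_range, nsmul_eq_mul]
  push_cast
  linarith

end TestVector

/-! ### Lower bounds for the norm -/

section PowerEstimates

variable {H : Type*} [NormedAddCommGroup H] [InnerProductSpace ℂ H] [CompleteSpace H]

theorem pow_nonneg_of_nonneg {a : H →L[ℂ] H} (ha : 0 ≤ a) (m : ℕ) : 0 ≤ a ^ m := by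
  have hsa : IsSelfAdjoint a := IsSelfAdjoint.of_nonneg ha
  rw [← cfc_pow_id (R := ℝ) a m hsa]
  exact cfc_nonneg fun x hx => pow_nonneg (spectrum_nonneg_of_nonneg ha hx) m

theorem exists_le_inner_pow_self (a : H →L[ℂ] H) (c : ℝ) (m : ℕ) :
    ∃ C : ℝ, 0 ≤ C ∧ ∀ f : H,
      c ^ m * ‖f‖ ^ 2 - C * ‖(a - algebraMap ℂ _ (c : ℂ)) f‖ * ‖f‖ ≤
        (inner ℂ f ((a ^ m) f)).re := by
  set z : H →L[ℂ] H := algebraMap ℂ _ (c : ℂ) with hz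
  have hcomm : Commute a z := (Algebra.commutes (c : ℂ) a).symm
  -- The cofactor in `aᵐ - cᵐ = Q (a - c)`; its norm is the constant `C`.
  set Q : H →L[ℂ] H := ∑ i ∈ Finset.range m, a ^ i * z ^ (m - 1 - i)
  have hQ : Q * (a - z) = a ^ m - z ^ m := hcomm.geom_sum₂_mul m
  refine ⟨‖Q‖, norm_nonneg _, fun f => ?_⟩
  have h1 : (a ^ m) f = Q ((a - z) f) + ((c ^ m : ℝ) : ℂ) • f := by
    have h := congrArg (fun T : H →L[ℂ] H => T f) hQ
    have h2 : (z ^ m) f = ((c ^ m : ℝ) : ℂ) • f := by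
      rw [hz, ← map_pow, Algebra.algebraMap_eq_smul_one]
      push_cast
      rfl
    simp only [mul_apply_eq_comp] at h
    rw [h, sub_apply, h2]
    abel
  rw [h1, inner_add_right, inner_smul_right, Complex.add_re, inner_self_eq_norm_sq_to_K]
  have h2 : (((c ^ m : ℝ) : ℂ) * (RCLike.ofReal ‖f‖ : ℂ) ^ 2).re = c ^ m * ‖f‖ ^ 2 := by
    change (((c ^ m : ℝ) : ℂ) * ((‖f‖ : ℝ) : ℂ) ^ 2).re = _
    rw [← Complex.ofReal_pow, ← Complex.ofReal_mul, Complex.ofReal_re]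
  have h3 : |(inner ℂ f (Q ((a - z) f))).re| ≤ ‖Q‖ * ‖(a - z) f‖ * ‖f‖ := by
    refine (Complex.abs_re_le_norm _).trans ((norm_inner_le_norm _ _).trans ?_)
    rw [mul_comm]
    exact mul_le_mul_of_nonneg_right (Q.le_opNorm _) (norm_nonneg _)
  have h4 := (abs_le.1 h3).1
  rw [h2]
  linarith

end PowerEstimates

/-! ### Strict inequality from a nontrivial relation -/

section Strict

variable {G : Type*} [Group G] {X : Finset G} {q : ℕ}

/-- The symmetric element obtained from `2 (h* h)ᵐ` by replacing the words `g` and `g⁻¹` by `1`. -/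
def perturbation (X : Finset G) (m : ℕ) (g : G) : MonoidAlgebra ℂ G :=
  (square X ^ m - MonoidAlgebra.of ℂ G g) + (square X ^ m - MonoidAlgebra.of ℂ G g⁻¹) + (1 + 1)

theorem regularRep_perturbation (X : Finset G) (m : ℕ) (g : G) :
    regularRep G (perturbation X m g) = regularRep G (square X) ^ m + regularRep G (square X) ^ m +
      star (1 - leftRegularRep G g) * (1 - leftRegularRep G g) := by
  have h : leftRegularRep G g⁻¹ * leftRegularRep G g = 1 := by
    rw [← map_mul, inv_mul_cancel, map_one]
  have hstar : star (1 - leftRegularRep G g) = 1 - leftRegularRep G g⁻¹ := by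
    rw [star_sub, star_one, ContinuousLinearMap.star_eq_adjoint, adjoint_leftRegularRep]
  rw [hstar, perturbation]
  simp only [map_add, map_sub, map_pow, regularRep_of, map_one]
  rw [sub_mul, one_mul, mul_sub, h, mul_one]
  abel

theorem regularRep_perturbation_nonneg (X : Finset G) (m : ℕ) (g : G) :
    0 ≤ regularRep G (perturbation X m g) := by
  rw [regularRep_perturbation]
  have h := pow_nonneg_of_nonneg (regularRep_square_nonneg X) m
  exact add_nonneg (add_nonneg h h) (star_mul_self_nonneg _)

theorem two_mul_lt_opNorm_perturbation (hq : 2 ≤ q) (hX : X.card = q + 1) (hfree : IsFree X)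
    {m : ℕ} (hm : 1 ≤ m) {w : List G} (hw : w ∈ listWords X (2 * m)) :
    2 * (4 * q : ℝ) ^ m < opNorm (perturbation X m (listProd w)) := by
  have hq1 : (2 : ℝ) ≤ q := by exact_mod_cast hq
  by_contra! hle
  obtain ⟨C, hC, hpow⟩ := exists_le_inner_pow_self (regularRep G (square X)) (4 * q) m
  set D : ℝ := 2 * (q + 1) ^ 2 + 2 * q
  have hD : 0 < D := by positivity
  -- The negated claim leads to `(K + 1)/4 ≤ 2CD‖f‖` with `‖f‖² ≤ 2(K + 1)`; squaring gives `K + 1 ≤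
  -- 128 (CD)²`.
  obtain ⟨K, hK⟩ := exists_nat_gt (128 * (C * D) ^ 2)
  have hK1 : 1 ≤ K := by
    by_contra h
    have : K = 0 := by omega
    subst this
    have : 0 ≤ 128 * (C * D) ^ 2 := by positivity
    simp at hK
    linarith
  have h1 := norm_square_sub_testVector_le (by omega) hX hfree hK1
  have h2 := norm_testVector_sq (by omega) hX hfree K
  have h3 := le_norm_testVector_sub_sq hq hX hfree hm hw K
  set f := testVector X q K
  have h4 := hpow f
  have h5 : ‖(regularRep G (square X) - algebraMap ℂ _ ((4 * q : ℝ) : ℂ)) f‖ ≤ D := by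
    have : ((4 * q : ℝ) : ℂ) = 4 * q := by push_cast; rfl
    rw [this]
    exact h1
  have h6 : C * ‖(regularRep G (square X) - algebraMap ℂ _ ((4 * q : ℝ) : ℂ)) f‖ * ‖f‖ ≤
      C * D * ‖f‖ := by gcongr
  have h7 : (inner ℂ f (regularRep G (perturbation X m (listProd w)) f)).re =
      2 * (inner ℂ f ((regularRep G (square X) ^ m) f)).re +
        ‖f - leftRegularRep G (listProd w) f‖ ^ 2 := by
    rw [regularRep_perturbation, add_apply, add_apply, inner_add_right, inner_add_right,
      mul_apply_eq_comp, ContinuousLinearMap.star_eq_adjoint,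
      ContinuousLinearMap.adjoint_inner_right, sub_apply, one_apply_eq_self,
      inner_self_eq_norm_sq_to_K, Complex.add_re, Complex.add_re, ← two_mul]
    congr 1
    exact (congrArg Complex.re (Complex.ofReal_pow _ _)).symm.trans (Complex.ofReal_re _)
  have h8 : (inner ℂ f (regularRep G (perturbation X m (listProd w)) f)).re ≤
      2 * (4 * q : ℝ) ^ m * ‖f‖ ^ 2 := by
    refine (Complex.re_le_norm _).trans ((norm_inner_le_norm _ _).trans ?_)
    have := (regularRep G (perturbation X m (listProd w))).le_opNorm f
    rw [← opNorm] at this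
    have h9 := mul_le_mul_of_nonneg_right hle (norm_nonneg f)
    nlinarith [norm_nonneg f]
  have h9 : (K + 1 : ℝ) / 4 ≤ 2 * (C * D * ‖f‖) := by
    rw [h7] at h8
    linarith
  have h10 : ‖f‖ ^ 2 ≤ 2 * (K + 1) := by
    rw [h2]
    have : ((q : ℝ) + 1) / q ≤ 2 := by
      rw [div_le_iff₀ (by linarith)]
      linarith
    nlinarith [Nat.cast_nonneg (α := ℝ) K]
  have h11 : ((K + 1 : ℝ) / 4) ^ 2 ≤ (2 * (C * D * ‖f‖)) ^ 2 := by gcongr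
  have h12 : (2 * (C * D * ‖f‖)) ^ 2 ≤ 4 * (C * D) ^ 2 * (2 * (K + 1)) := by
    calc (2 * (C * D * ‖f‖)) ^ 2 = 4 * (C * D) ^ 2 * ‖f‖ ^ 2 := by ring
      _ ≤ _ := by gcongr
  have h13 : (0 : ℝ) < K + 1 := by positivity
  nlinarith

end Strict

/-! ### Transfer of the norm bounds from the free group to `Γ` -/

section Main

variable {Γ : Type*} [Group Γ] {Y : Finset Γ} {q : ℕ}

theorem mapDomain_of {G : Type*} [Group G] (π : G →* Γ) (g : G) :
    MonoidAlgebra.mapDomainRingHom ℂ π (MonoidAlgebra.of ℂ G g) = MonoidAlgebra.of ℂ Γ (π g) := by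
  simp

theorem mapDomain_square_freeSet (Y : Finset Γ) :
    MonoidAlgebra.mapDomainRingHom ℂ (FreeGroup.lift (id : Γ → Γ)) (square (freeSet Y)) =
      square Y := by
  simp only [square, sumElt, invSet, freeSet, map_mul, map_sum, Finset.sum_map, mapDomain_of]
  simp

theorem opNorm_square (Y : Finset Γ) : opNorm (square Y) = opNorm (sumElt Y) ^ 2 :=
  norm_regularRep_square Y

theorem four_mul_le_opNorm_sumElt_sq (hq : 1 ≤ q) (hY : Y.card = q + 1) :
    4 * q ≤ opNorm (sumElt Y) ^ 2 := by
  have hX : (freeSet Y).card = q + 1 := by rw [freeSet, Finset.card_map, hY]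
  rw [← opNorm_square, ← mapDomain_square_freeSet]
  exact (four_mul_le_opNorm_square hq hX (isFree_freeSet Y)).trans
    (opNorm_le_opNorm_mapDomain _ (nonnegCoeff_square _) (regularRep_square_nonneg _))

theorem listProd_map {G : Type*} [Group G] (π : G →* Γ) (l : List G) :
    π (listProd l) = listProd (l.map π) := by
  induction l with
  | nil => simp [listProd]
  | cons a l ih =>
    rw [listProd, List.map_cons, listProd, map_mul, ih, List.length_map]
    split_ifs <;> simp

/-- A closed word in `Γ` lifts to a reduced word in the free group whose perturbation has norm above
`2(4q)ᵐ`. Its image is `2(h*h)ᵐ`, of norm at most `2‖h‖²ᵐ`. -/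
theorem four_mul_lt_opNorm_sumElt_sq (hq : 2 ≤ q) (hY : Y.card = q + 1) (hL : ¬ IsLeinert Y) :
    4 * q < opNorm (sumElt Y) ^ 2 := by
  rw [isLeinert_iff] at hL
  push Not at hL
  obtain ⟨m, hm, l, hl, h1⟩ := hL
  have hX : (freeSet Y).card = q + 1 := by rw [freeSet, Finset.card_map, hY]
  have hw := map_of_mem_listWords hl
  obtain ⟨hwlen, hwX, -⟩ := mem_listWords.1 hw
  set w := l.map FreeGroup.of with hwdef
  have hinv : (listProd w)⁻¹ = listProd w.reverse := by
    have := inv_listProd_mul_listProd w [] (by simp [hwlen])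
    simpa [listProd] using this
  have hnonneg : NonnegCoeff (perturbation (freeSet Y) m (listProd w)) := by
    refine NonnegCoeff.add (NonnegCoeff.add (nonnegCoeff_square_pow_sub m hwlen hwX) ?_)
      (nonnegCoeff_one.add nonnegCoeff_one)
    rw [hinv]
    exact nonnegCoeff_square_pow_sub m (by rw [List.length_reverse, hwlen])
      fun x hx => hwX x (List.mem_reverse.1 hx)
  have hπ : FreeGroup.lift (id : Γ → Γ) (listProd w) = 1 := by
    rw [listProd_map, hwdef, List.map_map]
    simpa [Function.comp_def] using h1
  have hmap : MonoidAlgebra.mapDomainRingHom ℂ (FreeGroup.lift (id : Γ → Γ))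
      (perturbation (freeSet Y) m (listProd w)) = square Y ^ m + square Y ^ m := by
    rw [perturbation]
    simp only [map_add, map_sub, map_pow, mapDomain_square_freeSet, mapDomain_of, hπ, map_inv,
      inv_one, map_one]
    abel
  have h2 := two_mul_lt_opNorm_perturbation hq hX (isFree_freeSet Y) hm hw
  have h3 := opNorm_le_opNorm_mapDomain (FreeGroup.lift (id : Γ → Γ)) hnonneg
    (regularRep_perturbation_nonneg _ _ _)
  have h4 : opNorm (square Y ^ m) ≤ (opNorm (sumElt Y) ^ 2) ^ m := by
    rw [← opNorm_square, opNorm, map_pow]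
    exact norm_pow_le' _ (by omega)
  rw [hmap] at h3
  have h5 := opNorm_add_le (square Y ^ m) (square Y ^ m)
  have h6 : (4 * q : ℝ) ^ m < (opNorm (sumElt Y) ^ 2) ^ m := by linarith
  exact lt_of_pow_lt_pow_left₀ m (by positivity) h6

end Main

end Cogrowth

end

theorem theorem6 {Γ : Type*} [Group Γ] (Y : Finset Γ) (q : ℕ) (hq : 1 ≤ q)
    (hY : Y.card = q + 1) (γ : ℝ)
    (hγ : γ = 1 / 2 * (Cogrowth.opNorm (Cogrowth.sumElt Y) +
      √(Cogrowth.opNorm (Cogrowth.sumElt Y) ^ 2 - 4 * (q : ℝ)))) :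
    (√(q : ℝ) ≤ γ ∧ γ ≤ (q : ℝ) ∧ γ + (q : ℝ) / γ = Cogrowth.opNorm (Cogrowth.sumElt Y)) ∧
    (¬ Cogrowth.IsLeinert Y → 2 ≤ q →
      √(q : ℝ) < γ ∧
      Tendsto (fun n : ℕ => Cogrowth.twoNorm (Cogrowth.hSeq Y n) ^ (1 / (n : ℝ))) atTop (𝓝 γ) ∧
      Tendsto (fun n : ℕ => Cogrowth.xi Y n ^ (1 / (2 * (n : ℝ)))) atTop (𝓝 γ) ∧
      Tendsto (fun n : ℕ => Cogrowth.eta Y n ^ (1 / (2 * (n : ℝ)))) atTop (𝓝 γ) ∧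
      Tendsto (fun n : ℕ => Cogrowth.zeta Y n ^ (1 / (2 * (n : ℝ)))) atTop (𝓝 γ)) := by
  have hN0 : 0 ≤ Cogrowth.opNorm (Cogrowth.sumElt Y) := Cogrowth.opNorm_nonneg _
  have hγ' : γ = Cogrowth.outer q (Cogrowth.opNorm (Cogrowth.sumElt Y) ^ 2) := by
    rw [hγ, Cogrowth.outer, Real.sqrt_sq hN0]
    ring
  have hN := Cogrowth.four_mul_le_opNorm_sumElt_sq hq hY
  have hq1 : (1 : ℝ) ≤ q := by exact_mod_cast hq
  refine ⟨⟨?_, ?_, ?_⟩, fun hL hq2 => ⟨?_, ?_⟩⟩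
  · rw [hγ', ← Cogrowth.outer_four_mul]
    exact Cogrowth.outer_mono q hN
  · have h1 := Cogrowth.opNorm_sumElt_le Y
    rw [hY] at h1
    push_cast at h1
    -- From `‖h‖ ≤ q + 1` one gets `‖h‖² - 4q ≤ (q - 1)²`.
    have h2 : √(Cogrowth.opNorm (Cogrowth.sumElt Y) ^ 2 - 4 * (q : ℝ)) ≤ q - 1 := by
      rw [Real.sqrt_le_left (by linarith)]
      nlinarith
    rw [hγ]
    linarith
  · obtain ⟨v, -, -, hv, hadd, -⟩ := Cogrowth.cheb_eq_outer hN
    rw [Real.sqrt_sq hN0, ← hγ'] at hadd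
    rw [← hγ'] at hv
    have hγ0 : γ ≠ 0 := by
      rintro rfl
      rw [zero_mul] at hv
      linarith
    rw [← hv, mul_div_cancel_left₀ v hγ0, hadd]
  · have h1 := Cogrowth.four_mul_lt_opNorm_sumElt_sq hq2 hY hL
    rw [hγ', ← Cogrowth.outer_four_mul, Cogrowth.outer, Cogrowth.outer, sub_self, Real.sqrt_zero]
    have h2 := Real.sqrt_lt_sqrt (by positivity) h1
    have h3 := Real.sqrt_nonneg (Cogrowth.opNorm (Cogrowth.sumElt Y) ^ 2 - 4 * (q : ℝ))
    linarith
  · exact Cogrowth.tendsto_roots hq hY (Cogrowth.four_mul_lt_opNorm_sumElt_sq hq2 hY hL) hγ'
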